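/- Let $n\ge 4$, let $\varepsilon_1,\dots,\varepsilon_n$ be the standard orthonormal basis in which the roots of type $\mathsf D_n$ are $\pm(\varepsilon_i\pm\varepsilon_j)$, $i<j$, with positive roots $\varepsilon_i\pm\varepsilon_j$, $i<j$, and put $\varepsilon_{-i}:=-\varepsilon_i$ and $\mathbf I_n:=\{\pm1,\dots,\pm n\}$. Let $m_o$ be the least positive integer with $m_o(\lambda,\mu)\in\mathbb Z$ for all $\lambda,\mu$ in the weight lattice, let $\hat q$ be an indeterminate, $\mathbb K=\mathbb C(\hat q)$ and $q=\hat q^{\,m_o}$. For an integer $k\ge 0$ put \[ G_{n,k}=\sum_{a\in\mathbf I_n}L_a^k\prod_{b\in\mathbf I_n\setminus\{\pm a\}}\frac{qL_a-q^{-1}L_b}{L_a-L_b}, \] and let $\mathbf{Ch}\,G_{n,k}$ be the expression obtained by replacing each $L_a$ by the formal exponential $e^{\varepsilon_a}$; it is an element of the field of fractions of the group ring over $\mathbb K$ of the lattice $\bigoplus_i\mathbb Z\varepsilon_i$. For $0\le r\le 2n-2$ let $\bar r=\min\{r,2n-2-r\}$ and \[ \lambda_k^r=(k-r)\varepsilon_1+\varepsilon_2+\cdots+\varepsilon_{\bar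 r+1},\qquad \bar\lambda_k^{\,n-1}=(k-n+1)\varepsilon_1+\varepsilon_2+\cdots+\varepsilon_{n-1}-\varepsilon_n, \] where $\varepsilon_2+\cdots+\varepsilon_{\bar r+1}$ means $0$ if $\bar r=0$. For a dominant integral weight $\lambda$ let $\chi(\lambda)=\sum_\mu \dim L(\lambda)_\mu\, e^\mu$ be the character of the simple $\mathfrak{so}_{2n}(\mathbb C)$-module $L(\lambda)$ of highest weight $\lambda$. Then for all integers $k\ge 0$ \[ \mathbf{Ch}\,G_{n,k}= \begin{cases} 1+\displaystyle\sum_{r=0}^{2n-2}q^{2n-2-2r}, & k=0,\\ q^{-k}+\displaystyle\sum_{r=0}^{k-1}(-1)^rq^{2n-2-2r}\Big(\chi(\lambda_k^r)+\delta_{r,n-1}\,\chi(\bar\lambda_k^{\,n-1})\Big), & 1\le k\le 2n-2 \text{ and } k \text{ even},\\ \displaystyle\sum_{r=0}^{\min\{k-1,\,2n-2\}}(-1)^rq^{2n-2-2r}\Big(\chi(\lambda_k^r)+\delta_{r,n-1}\,\chi(\bar\lambda_k^{\,n-1})\Big), & \text{otherwise.} \end{cases} \] -/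

import Mathlib

noncomputable section

namespace TypeD

/-! ### Scalars -/

/-- The weight lattice `P` of type `D_n` in coordinates with respect to `ε_1, …, ε_n`: all `x` with
`2 (x, α) / (α, α) ∈ ℤ` for every root `α = ±(ε_i ± ε_j)`, `i ≠ j`; all roots have
`(α, α) = 2`. -/
def weightLattice (n : ℕ) : Set (Fin n → ℚ) :=
  {x | ∀ i j : Fin n, i ≠ j → (∃ z : ℤ, x i - x j = z) ∧ (∃ z : ℤ, x i + x j = z)}

/-- The least positive integer `m` with `m (x, y) ∈ ℤ` for all `x, y ∈ P`. -/
def mO (n : ℕ) : ℕ :=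
  sInf {m : ℕ | 0 < m ∧ ∀ x ∈ weightLattice n, ∀ y ∈ weightLattice n,
    ∃ z : ℤ, (∑ i, x i * y i) * (m : ℚ) = z}

/-- The field `ℂ(q̂)` of rational functions in the indeterminate `q̂`. -/
abbrev K : Type := RatFunc ℂ

/-- `q = q̂ ^ m_o`. -/
def q (n : ℕ) : K := RatFunc.X ^ mO n

/-! ### Formal exponentials

The weights that occur below all lie in `ℤ ε_1 ⊕ ⋯ ⊕ ℤ ε_n`, a lattice that contains the roots.
It is modelled by `Fin n → ℤ`; the basis vector `ε_1` has index `0`. -/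

/-- The group ring `K[ℤ ε_1 ⊕ ⋯ ⊕ ℤ ε_n]` of formal exponentials. -/
abbrev ExpRing (n : ℕ) : Type := AddMonoidAlgebra K (Fin n → ℤ)

/-- The field of fractions of the group ring of formal exponentials. -/
abbrev ExpField (n : ℕ) : Type := FractionRing (ExpRing n)

/-- The formal exponential `e^μ`. -/
def e {n : ℕ} (μ : Fin n → ℤ) : ExpField n :=
  algebraMap (ExpRing n) (ExpField n) (AddMonoidAlgebra.single μ 1)

/-- `q` as an element of the field of fractions. -/
def qE (n : ℕ) : ExpField n := algebraMap K (ExpField n) (q n)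

/-- The index set `I_n = {±1, …, ±n}`; the pair `(i, s)` stands for the number `i` with the
sign `s`. -/
abbrev Idx (n : ℕ) : Type := Fin n × ℤˣ

/-- The index `-a`. -/
def Idx.opp {n : ℕ} (a : Idx n) : Idx n := (a.1, -a.2)

/-- The weight `ε_a`, where `ε_{-a} = -ε_a`. -/
def eps {n : ℕ} (a : Idx n) : Fin n → ℤ := Pi.single a.1 (a.2 : ℤ)

/-! ### The elements `G_{n,k}` -/

/-- `P_{n,a} = ∏_{b ≠ ±a} (q L_a - q⁻¹ L_b) / (L_a - L_b)`. -/
def prodP {n : ℕ} {F : Type*} [Field F] (q : F) (L : Idx n → F) (a : Idx n) : F :=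
  ∏ b ∈ Finset.univ \ {a, a.opp}, (q * L a - q⁻¹ * L b) / (L a - L b)

/-- `G_{n,k} = ∑_a L_a ^ k P_{n,a}`. -/
def G {n : ℕ} {F : Type*} [Field F] (q : F) (L : Idx n → F) (k : ℕ) : F :=
  ∑ a : Idx n, L a ^ k * prodP q L a

/-- `Ch G_{n,k}`, obtained by replacing each `L_a` in `G_{n,k}` with `e^{ε_a}`. -/
def chG (n k : ℕ) : ExpField n := G (qE n) (fun a : Idx n => e (eps a)) k

/-! ### The Lie algebra `𝔰𝔬_{2n}` and its simple highest weight modules -/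

/-- The split form of `𝔰𝔬_{2n}(ℂ)`: the matrices that are skew-adjoint for the symmetric form with
block matrix `(0, 1; 1, 0)`. Its diagonal matrices form a Cartan subalgebra. -/
abbrev so (n : ℕ) : Type := LieAlgebra.Orthogonal.typeD (Fin n) ℂ

theorem mem_typeD_of_blocks {n : ℕ} (A B : Matrix (Fin n) (Fin n) ℂ) (hB : B.transpose = -B) :
    Matrix.fromBlocks A B 0 (-A.transpose) ∈ LieAlgebra.Orthogonal.typeD (Fin n) ℂ := by
  rw [LieAlgebra.Orthogonal.typeD, mem_skewAdjointMatricesLieSubalgebra,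
    mem_skewAdjointMatricesSubmodule]
  simp [Matrix.IsSkewAdjoint, Matrix.IsAdjointPair, LieAlgebra.Orthogonal.JD,
    Matrix.fromBlocks_transpose, Matrix.fromBlocks_multiply, Matrix.fromBlocks_neg, hB]

/-- The element `(A, B; 0, -Aᵀ)` of `𝔰𝔬_{2n}`, for a skew-symmetric matrix `B`. -/
def blocks {n : ℕ} (A B : Matrix (Fin n) (Fin n) ℂ) (hB : B.transpose = -B) : so n :=
  ⟨Matrix.fromBlocks A B 0 (-A.transpose), mem_typeD_of_blocks A B hB⟩

/-- The basis `h_1, …, h_n` of the Cartan subalgebra dual to `ε_1, …, ε_n`. -/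
def cartan {n : ℕ} (i : Fin n) : so n :=
  blocks (Matrix.single i i 1) 0 (by simp)

/-- A root vector for the root `ε_i - ε_j`. -/
def rootVecSub {n : ℕ} (i j : Fin n) : so n :=
  blocks (Matrix.single i j 1) 0 (by simp)

/-- A root vector for the root `ε_i + ε_j`. -/
def rootVecAdd {n : ℕ} (i j : Fin n) : so n :=
  blocks 0 (Matrix.single i j 1 - Matrix.single j i 1) (by simp)

/-- The universal enveloping algebra of `𝔰𝔬_{2n}`; its left modules are the
`𝔰𝔬_{2n}`-modules. -/
abbrev U (n : ℕ) : Type := UniversalEnvelopingAlgebra ℂ (so n)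

/-- The inclusion of `𝔰𝔬_{2n}` in its universal enveloping algebra. -/
abbrev toU {n : ℕ} (x : so n) : U n := UniversalEnvelopingAlgebra.ι ℂ x

/-- The left ideal generated by the root vectors of the positive roots `ε_i ± ε_j`, `i < j`, and by
the elements `h - lam(h)`, `h` in the Cartan subalgebra. The Verma module of highest weight `lam` is
the quotient of `U n` by it. -/
def vermaIdeal {n : ℕ} (lam : Fin n → ℤ) : Submodule (U n) (U n) :=
  Submodule.span (U n)
    ({u | ∃ i j : Fin n, i < j ∧ (u = toU (rootVecSub i j) ∨ u = toU (rootVecAdd i j))} ∪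
      {u | ∃ i : Fin n, u = toU (cartan i) - algebraMap ℂ (U n) (lam i : ℂ)})

/-- The sum of all proper left ideals that contain `vermaIdeal lam`; it corresponds to the largest
proper submodule of the Verma module. -/
def maxIdeal {n : ℕ} (lam : Fin n → ℤ) : Submodule (U n) (U n) :=
  sSup {I | vermaIdeal lam ≤ I ∧ I ≠ ⊤}

/-- The simple `𝔰𝔬_{2n}`-module `L(lam)` of highest weight `lam`: the simple quotient of the Verma
module. -/
abbrev L {n : ℕ} (lam : Fin n → ℤ) : Type := U n ⧸ maxIdeal lam

/-- The weight space `L(lam)_μ`. -/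
def weightSpace {n : ℕ} (lam μ : Fin n → ℤ) : Submodule ℂ (L lam) where
  carrier := {v | ∀ i, toU (cartan i) • v = algebraMap ℂ (U n) (μ i : ℂ) • v}
  zero_mem' := by intro i; simp
  add_mem' := by
    intro v w hv hw i
    rw [smul_add, smul_add, hv i, hw i]
  smul_mem' := by
    intro c v hv i
    rw [smul_comm, hv i, smul_comm]

/-- The character `χ(lam) = ∑_μ dim L(lam)_μ e^μ`. -/
def chi {n : ℕ} (lam : Fin n → ℤ) : ExpField n :=
  ∑ᶠ μ : Fin n → ℤ, (Module.finrank ℂ (weightSpace lam μ) : ExpField n) * e μ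

/-! ### The hook weights -/

/-- `λ_k^r = (k - r) ε_1 + (ε_2 + ⋯ + ε_{r̄+1})` with `r̄ = min {r, 2n - 2 - r}`. -/
def hook (n k r : ℕ) : Fin n → ℤ := fun i =>
  if i.val = 0 then (k : ℤ) - r
  else if i.val ≤ min r (2 * n - 2 - r) then 1 else 0

/-- `λ̄_k^{n-1} = (k - n + 1) ε_1 + (ε_2 + ⋯ + ε_{n-1}) - ε_n`. -/
def hookBar (n k : ℕ) : Fin n → ℤ := fun i =>
  if i.val = 0 then (k : ℤ) - n + 1
  else if i.val = n - 1 then -1 else 1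

end TypeD

end

/-! Put x_i = e^{ε_i}, y_i = x_i + x_i⁻¹, ρ = (n-1, …, 0) and D(m) = det(x_i^{m_c} + x_i^{-m_c}).
Pairing the factors b = ±j turns the product P_a, a = ±i, into the Lagrange basis polynomial of the
node y_i, evaluated at z + z⁻¹ with z = q² L_a. Since z^m + z^{-m} is a polynomial of degree m in z
+ z⁻¹, interpolation identifies D(ρ) P_a with D(ρ) after its i-th row is rewritten at z. Expanding
along rows, summing over a and reassembling along columns gives D(ρ) G_{n,k} = Σ_c (q^{2ρ_c} D(ρ
with ρ_c → k + ρ_c) + q^{-2ρ_c} D(ρ with ρ_c → k - ρ_c)) (`det_mul_G`).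

Label the two terms of column c by r = c and r = 2n-2-c; the r-th term then has the new exponent k -
r + n - 1 in column r̄. If r < k, moving this column to the front costs (-1)^r and leaves D(λ_k^r +
ρ). If r ≥ k ≥ 1, the new exponent is up to sign an entry of ρ: two columns agree and the term
vanishes, unless the entry is that of the replaced column itself. The latter means 2r = 2n-2+k and
produces q^{-k}. The label r = n-1 occurs twice, which accounts for δ_{r,n-1}.

What remains is the Weyl character formula: D(ρ) χ(λ) = D(λ+ρ) if λ_n = 0, and D(ρ)(χ(λ) + χ(λ̄)) =
2 D(λ+ρ) if λ_n ≠ 0, where λ̄ has the last sign flipped. It is proved for the quotient of the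
enveloping algebra by `maxIdeal`. Finite dimension comes from explicit modules inside tensor
products of exterior algebras (`HasHighest`), invariance of multiplicities from 𝔰𝔩₂-theory
(`finrank_wtSpace_refl`). Traces of the Casimir element show that D(ρ) times the character is an
eigenvector of the Laplace operator (`exists_laplace_alternant_mul`). Hence all its exponents have
the norm of λ+ρ and lie below λ+ρ, and the only strictly dominant one is λ+ρ itself. An alternating
element is determined by its strictly dominant coefficients (`IsAlt.eq_zero`). -/

namespace TypeD

/-! ### The sum `G` by Lagrange interpolation -/

/-! ### Determinants of Laurent monomials -/

/-- `x ^ s + x ^ (-s)`. -/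
def symPow {F : Type*} [Field F] (x : F) (s : ℤ) : F := x ^ s + x ^ (-s)

theorem symPow_neg {F : Type*} [Field F] (x : F) (s : ℤ) : symPow x (-s) = symPow x s := by
  simp [symPow, add_comm]

/-- The matrix with entries `x_i ^ m_c + x_i ^ (-m_c)`. -/
def expMat {F : Type*} [Field F] {n : ℕ} (x : Fin n → F) (m : Fin n → ℤ) :
    Matrix (Fin n) (Fin n) F :=
  Matrix.of fun i c => symPow (x i) (m c)

/-- The weight `ρ = (n - 1, n - 2, …, 0)`. -/
def rho {n : ℕ} : Fin n → ℤ := fun c => (n : ℤ) - 1 - c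

theorem expMat_update {F : Type*} [Field F] {n : ℕ} (x : Fin n → F) (m : Fin n → ℤ) (c : Fin n)
    (s : ℤ) :
    expMat x (Function.update m c s) = (expMat x m).updateCol c fun i => symPow (x i) s := by
  ext i j
  by_cases h : j = c
  · subst h; simp [expMat]
  · simp [expMat, h]

theorem chebyshev_C_natDegree_le (R : Type*) [CommRing R] (m : ℕ) :
    (Polynomial.Chebyshev.C R m).natDegree ≤ m := by
  induction m using Nat.twoStepInduction with
  | zero =>
    simp only [Nat.cast_zero, Polynomial.Chebyshev.C_zero]
    exact (Polynomial.natDegree_ofNat (R := R) 2).le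
  | one => simpa using Polynomial.natDegree_X_le
  | more m h0 h1 =>
    push_cast
    rw [Polynomial.Chebyshev.C_add_two]
    push_cast at h1
    refine (Polynomial.natDegree_sub_le _ _).trans (max_le ?_ (by omega))
    refine Polynomial.natDegree_mul_le.trans ?_
    have := Polynomial.natDegree_X_le (R := R)
    omega

theorem chebyshev_C_eval_add {R : Type*} [CommRing R] {x X : R} (h : x * X = 1) (m : ℕ) :
    (Polynomial.Chebyshev.C R m).eval (x + X) = x ^ m + X ^ m := by
  induction m using Nat.twoStepInduction with
  | zero => norm_num
  | one => simp
  | more m h0 h1 =>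
    push_cast at h1 ⊢
    rw [Polynomial.Chebyshev.C_add_two]
    simp only [Polynomial.eval_sub, Polynomial.eval_mul, Polynomial.eval_X, h0, h1]
    linear_combination (x ^ m + X ^ m) * h

theorem symPow_eq_eval {F : Type*} [Field F] {x : F} (hx : x ≠ 0) (m : ℕ) :
    symPow x m = (Polynomial.Chebyshev.C F m).eval (x + x⁻¹) := by
  rw [chebyshev_C_eval_add (mul_inv_cancel₀ hx)]
  simp [symPow]

theorem rho_eq_natCast {n : ℕ} (c : Fin n) : (rho c : ℤ) = ((n - 1 - c : ℕ) : ℤ) := by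
  have := c.2
  simp only [rho]; omega

/-- The entries of a row are polynomials of degree less than n in the node x + x⁻¹. The row at z is
therefore the Lagrange combination of the n given rows, and in the determinant only the coefficient
of row i survives. -/
theorem det_updateRow_symPow {F : Type*} [Field F] {n : ℕ} {x : Fin n → F} (hx : ∀ i, x i ≠ 0)
    (hy : Function.Injective fun i => x i + (x i)⁻¹) {z : F} (hz : z ≠ 0) (i : Fin n) :
    ((expMat x rho).updateRow i fun c => symPow z (rho c)).det =
      (∏ j ∈ Finset.univ.erase i,
        (z + z⁻¹ - (x j + (x j)⁻¹)) / (x i + (x i)⁻¹ - (x j + (x j)⁻¹))) *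
        (expMat x rho).det := by
  set y : Fin n → F := fun i => x i + (x i)⁻¹ with hydef
  have hrow : (fun c : Fin n => symPow z (rho c)) = ∑ k : Fin n,
      (Lagrange.basis Finset.univ y k).eval (z + z⁻¹) • (expMat x rho) k := by
    ext c
    have hdeg : (Polynomial.Chebyshev.C F ((n - 1 - c : ℕ) : ℤ)).degree <
        (Finset.univ : Finset (Fin n)).card := by
      refine lt_of_le_of_lt Polynomial.degree_le_natDegree ?_
      have := chebyshev_C_natDegree_le F (n - 1 - c)
      have hc := c.2
      simp only [Finset.card_univ, Fintype.card_fin]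
      exact_mod_cast lt_of_le_of_lt this (by omega)
    have := Lagrange.eq_interpolate (s := Finset.univ) (v := y) (hy.injOn) hdeg
    rw [rho_eq_natCast, symPow_eq_eval hz, this, Lagrange.interpolate_apply,
      Polynomial.eval_finsetSum]
    simp only [Finset.sum_apply, Pi.smul_apply, smul_eq_mul, Polynomial.eval_mul,
      Polynomial.eval_C, expMat, Matrix.of_apply]
    refine Finset.sum_congr rfl fun k _ => ?_
    rw [rho_eq_natCast, symPow_eq_eval (hx k), mul_comm]
  rw [hrow, Matrix.det_updateRow_sum, Lagrange.basis, Polynomial.eval_prod, smul_eq_mul]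
  congr 1
  refine Finset.prod_congr rfl fun j _ => ?_
  simp only [Lagrange.basisDivisor, Polynomial.eval_mul, Polynomial.eval_C, Polynomial.eval_sub,
    Polynomial.eval_X, hydef]
  rw [div_eq_mul_inv, mul_comm]

/-- The factors for b = ±j multiply to L (q²L + (q²L)⁻¹ - y_j) in the numerator and L (L + L⁻¹ -
y_j) in the denominator. The result is exactly the factor of `det_updateRow_symPow` at z = q²L. -/
theorem prodP_eq {F : Type*} [Field F] {n : ℕ} {x : Fin n → F} (hx : ∀ i, x i ≠ 0) {q : F}
    (hq : q ≠ 0) {L : Idx n → F} (hL : ∀ i, L (i, 1) = x i) (hL' : ∀ i, L (i, -1) = (x i)⁻¹)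
    (i : Fin n) (s : ℤˣ) :
    prodP q L (i, s) = ∏ j ∈ Finset.univ.erase i,
      (q ^ 2 * L (i, s) + (q ^ 2 * L (i, s))⁻¹ - (x j + (x j)⁻¹)) /
        (x i + (x i)⁻¹ - (x j + (x j)⁻¹)) := by
  have hset : (Finset.univ \ {(i, s), Idx.opp (i, s)} : Finset (Idx n)) =
      (Finset.univ.erase i) ×ˢ (Finset.univ : Finset ℤˣ) := by
    ext ⟨j, t⟩
    simp only [Idx.opp, Finset.mem_sdiff, Finset.mem_univ, Finset.mem_insert, Prod.mk.injEq,
      Finset.mem_singleton, Finset.mem_product, Finset.mem_erase, true_and, and_true]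
    rcases Int.units_eq_one_or s with rfl | rfl <;> rcases Int.units_eq_one_or t with rfl | rfl <;>
      simp
  have hs : L (i, s) ≠ 0 ∧ L (i, s) + (L (i, s))⁻¹ = x i + (x i)⁻¹ := by
    rcases Int.units_eq_one_or s with rfl | rfl
    · rw [hL]; exact ⟨hx i, rfl⟩
    · rw [hL']; exact ⟨inv_ne_zero (hx i), by rw [inv_inv, add_comm]⟩
  obtain ⟨h0, h1⟩ := hs
  rw [prodP, hset, Finset.prod_product]
  refine Finset.prod_congr rfl fun j _ => ?_
  rw [UnitsInt.univ, Finset.prod_pair (by decide), hL, hL', div_mul_div_comm, ← h1]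
  refine Eq.trans ?_ (mul_div_mul_left _ _ h0)
  have hj := hx j
  congr 1
  · field_simp
    ring
  · field_simp
    ring

/-- Each summand is a determinant with one modified row, hence a combination of cofactors. After the
sum over rows is moved inside, the same cofactors are those of a modified column. -/
theorem det_mul_G {F : Type*} [Field F] {n : ℕ} {x : Fin n → F} (hx : ∀ i, x i ≠ 0)
    (hy : Function.Injective fun i => x i + (x i)⁻¹) {q : F} (hq : q ≠ 0) {L : Idx n → F}
    (hL : ∀ i, L (i, 1) = x i) (hL' : ∀ i, L (i, -1) = (x i)⁻¹) (k : ℕ) :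
    (expMat x rho).det * G q L k = ∑ c : Fin n,
      (q ^ (2 * rho c) * (expMat x (Function.update rho c (k + rho c))).det +
        q ^ (-(2 * rho c)) * (expMat x (Function.update rho c (k - rho c))).det) := by
  have hrow : ∀ (i : Fin n) (s : ℤˣ), (expMat x rho).det * (L (i, s) ^ k * prodP q L (i, s)) =
      ∑ c, L (i, s) ^ k * symPow (q ^ 2 * L (i, s)) (rho c) * (expMat x rho).adjugate c i := by
    intro i s
    have h0 : L (i, s) ≠ 0 := by
      rcases Int.units_eq_one_or s with rfl | rfl
      · rw [hL]; exact hx i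
      · rw [hL']; exact inv_ne_zero (hx i)
    have := det_updateRow_symPow hx hy (z := q ^ 2 * L (i, s)) (by positivity) i
    rw [← prodP_eq hx hq hL hL'] at this
    rw [mul_left_comm, mul_comm (Matrix.det _), ← this, ← Matrix.cramer_transpose_apply,
      Matrix.cramer_eq_adjugate_mulVec, ← Matrix.adjugate_transpose, Matrix.mulVec, dotProduct,
      Finset.mul_sum]
    refine Finset.sum_congr rfl fun c _ => ?_
    simp only [Matrix.transpose_apply]
    ring
  have hcol : ∀ (c : Fin n) (s : ℤ), (expMat x (Function.update rho c s)).det =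
      ∑ i, symPow (x i) s * (expMat x rho).adjugate c i := by
    intro c s
    rw [expMat_update, ← Matrix.cramer_apply, Matrix.cramer_eq_adjugate_mulVec, Matrix.mulVec,
      dotProduct]
    exact Finset.sum_congr rfl fun i _ => mul_comm _ _
  rw [G, Finset.mul_sum, Fintype.sum_prod_type]
  simp only [hrow, hcol]
  rw [Finset.sum_congr rfl fun i _ => Finset.sum_comm, Finset.sum_comm]
  refine Finset.sum_congr rfl fun c _ => ?_
  rw [Finset.mul_sum, Finset.mul_sum, ← Finset.sum_add_distrib]
  refine Finset.sum_congr rfl fun i _ => ?_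
  -- The signs ±i together contribute q^{2ρ_c} (x^{k+ρ_c} + x^{-k-ρ_c}) + q^{-2ρ_c} (x^{k-ρ_c} +
  -- x^{ρ_c-k}).
  rw [UnitsInt.univ, Finset.sum_pair (by decide), hL, hL', ← add_mul, ← mul_assoc, ← mul_assoc,
    ← add_mul]
  congr 1
  have hi := hx i
  simp only [symPow, mul_zpow, inv_zpow', ← zpow_natCast, ← zpow_mul, neg_neg, neg_add,
    zpow_add₀ hi, sub_eq_add_neg, Nat.cast_ofNat, mul_neg]
  ring

end TypeD

/-! ### The group ring: roots as differences of signed basis weights, alternating elements, the Weyl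
denominator -/

noncomputable section

namespace TypeD

/-! ### Formal exponentials with complex coefficients -/

/-- The group ring `ℂ[ℤ ε_1 ⊕ ⋯ ⊕ ℤ ε_n]`. -/
abbrev CExp (n : ℕ) : Type := AddMonoidAlgebra ℂ (Fin n → ℤ)

/-- The formal exponential `e^μ` with complex coefficients. -/
def mono {n : ℕ} (μ : Fin n → ℤ) : CExp n := AddMonoidAlgebra.single μ 1

theorem mono_mul {n : ℕ} (μ ν : Fin n → ℤ) : mono μ * mono ν = mono (μ + ν) := by
  simp [mono]

theorem mono_zero {n : ℕ} : mono (0 : Fin n → ℤ) = 1 := rfl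

theorem coeff_mono {n : ℕ} (μ ν : Fin n → ℤ) :
    (mono μ).coeff ν = if μ = ν then 1 else 0 := by
  simp [mono, Finsupp.single_apply]

theorem coeff_mono_mul {n : ℕ} (μ : Fin n → ℤ) (f : CExp n) (ν : Fin n → ℤ) :
    (mono μ * f).coeff ν = f.coeff (ν - μ) := by
  simp [mono, sub_eq_neg_add]

/-- The derivation `e^μ ↦ φ(μ) e^μ`. -/
def derivLin {n : ℕ} (φ : (Fin n → ℤ) →+ ℤ) : CExp n →ₗ[ℂ] CExp n where
  toFun f := .ofCoeff (Finsupp.onFinset f.coeff.support (fun ν => (φ ν : ℂ) * f.coeff ν)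
    (by intro ν h; rw [Finsupp.mem_support_iff]; exact right_ne_zero_of_mul h))
  map_add' f g := by ext ν; simp [mul_add]
  map_smul' c f := by ext ν; simp; ring

theorem coeff_derivLin {n : ℕ} (φ : (Fin n → ℤ) →+ ℤ) (f : CExp n) (ν : Fin n → ℤ) :
    (derivLin φ f).coeff ν = (φ ν : ℂ) * f.coeff ν := by
  simp [derivLin]

theorem derivLin_single {n : ℕ} (φ : (Fin n → ℤ) →+ ℤ) (μ : Fin n → ℤ) (c : ℂ) :
    derivLin φ (AddMonoidAlgebra.single μ c) = (φ μ : ℂ) • AddMonoidAlgebra.single μ c := by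
  ext ν
  rw [coeff_derivLin]
  by_cases h : μ = ν
  · subst h; simp
  · simp [h]

theorem derivLin_mul {n : ℕ} (φ : (Fin n → ℤ) →+ ℤ) (f g : CExp n) :
    derivLin φ (f * g) = f * derivLin φ g + g * derivLin φ f := by
  induction f using AddMonoidAlgebra.induction_linear with
  | zero => simp
  | add f₁ f₂ h₁ h₂ => rw [add_mul, map_add, h₁, h₂, map_add]; ring
  | single μ c =>
    induction g using AddMonoidAlgebra.induction_linear with
    | zero => simp
    | add f₁ f₂ h₁ h₂ => rw [mul_add, map_add, h₁, h₂, map_add]; ring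
    | single ν d =>
      rw [AddMonoidAlgebra.single_mul_single, derivLin_single, derivLin_single, derivLin_single,
        map_add, mul_smul_comm, mul_smul_comm, AddMonoidAlgebra.single_mul_single,
        AddMonoidAlgebra.single_mul_single, add_comm ν μ, mul_comm d c, ← add_smul]
      push_cast
      rw [add_comm (φ μ : ℂ)]

/-- The derivation `e^μ ↦ φ(μ) e^μ`. -/
def deriv {n : ℕ} (φ : (Fin n → ℤ) →+ ℤ) : Derivation ℂ (CExp n) (CExp n) :=
  Derivation.mk' (derivLin φ) fun f g => by simpa using derivLin_mul φ f g

theorem coeff_deriv {n : ℕ} (φ : (Fin n → ℤ) →+ ℤ) (f : CExp n) (ν : Fin n → ℤ) :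
    (deriv φ f).coeff ν = (φ ν : ℂ) * f.coeff ν := coeff_derivLin φ f ν

theorem deriv_mono {n : ℕ} (φ : (Fin n → ℤ) →+ ℤ) (μ : Fin n → ℤ) :
    deriv φ (mono μ) = (φ μ : ℂ) • mono μ := derivLin_single φ μ 1

/-! ### Weights -/

/-- The weight `ε_i` or `-ε_i` of a basis vector of the natural module. -/
def wt {n : ℕ} : Fin n ⊕ Fin n → Fin n → ℤ :=
  Sum.elim (fun i => Pi.single i 1) fun i => -Pi.single i 1

@[simp] theorem wt_inl {n : ℕ} (i : Fin n) : wt (.inl i) = Pi.single i 1 := rfl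

@[simp] theorem wt_inr {n : ℕ} (i : Fin n) : wt (.inr i) = -Pi.single i 1 := rfl

theorem wt_swap {n : ℕ} (a : Fin n ⊕ Fin n) : wt a.swap = -wt a := by
  cases a <;> simp

/-- The weights that pair strictly with all positive roots `wt a - wt b`. -/
def StrictDom {n : ℕ} (ν : Fin n → ℤ) : Prop :=
  ∀ a b : Fin n ⊕ Fin n, rho ⬝ᵥ wt b < rho ⬝ᵥ wt a → b ≠ a.swap → ν ⬝ᵥ wt b < ν ⬝ᵥ wt a

theorem strictDom_rho {n : ℕ} : StrictDom (rho : Fin n → ℤ) := fun _ _ h _ => h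

theorem StrictDom.add {n : ℕ} {μ ν : Fin n → ℤ} (hμ : StrictDom μ) (hν : StrictDom ν) :
    StrictDom (μ + ν) := by
  intro a b h h'
  rw [add_dotProduct, add_dotProduct]
  exact add_lt_add (hμ a b h h') (hν a b h h')

theorem StrictDom.abs_lt {n : ℕ} {ν : Fin n → ℤ} (hν : StrictDom ν) {i j : Fin n} (h : i < j) :
    |ν j| < ν i := by
  have hi := i.2
  have hj := j.2
  have hlt : (i : ℕ) < j := h
  have h1 := hν (.inl i) (.inl j) (by simp [rho]; omega) (by simp)
  have h2 := hν (.inl i) (.inr j) (by simp [rho]; omega) (by simp; exact h.ne')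
  simp at h1 h2
  rw [_root_.abs_lt]
  omega

theorem strictDom_of_abs_lt {n : ℕ} {ν : Fin n → ℤ} (hν : ∀ i j, i < j → |ν j| < ν i) :
    StrictDom ν := by
  rintro (i | i) (j | j) h h' <;> simp [rho] at h h' ⊢
  · exact (le_abs_self _).trans_lt (hν i j h)
  · rcases lt_or_gt_of_ne h' with h | h
    · have := hν j i h; rw [_root_.abs_lt] at this; omega
    · have := hν i j h; rw [_root_.abs_lt] at this; omega
  · have := i.2; have := j.2; omega
  · have := hν j i h; rw [_root_.abs_lt] at this; omega

/-- The monoid generated by the positive roots. -/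
def posCone (n : ℕ) : AddSubmonoid (Fin n → ℤ) :=
  AddSubmonoid.closure {α | ∃ a b : Fin n ⊕ Fin n,
    rho ⬝ᵥ wt b < rho ⬝ᵥ wt a ∧ b ≠ a.swap ∧ α = wt a - wt b}

theorem posCone_dotProduct {n : ℕ} {x y : Fin n → ℤ} (hx : x ∈ posCone n) (hy : StrictDom y) :
    x = 0 ∨ 0 < y ⬝ᵥ x := by
  induction hx using AddSubmonoid.closure_induction with
  | mem x hx =>
    obtain ⟨a, b, h, h', rfl⟩ := hx
    right
    rw [dotProduct_sub]
    exact sub_pos.2 (hy a b h h')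
  | zero => exact Or.inl rfl
  | add x z _ _ hx hz =>
    rcases hx with rfl | hx
    · simpa using hz
    · rcases hz with rfl | hz
      · right; simpa using hx
      · right; rw [dotProduct_add]; exact add_pos hx hz

theorem posCone_antisymm {n : ℕ} {x : Fin n → ℤ} (hx : x ∈ posCone n) (hx' : -x ∈ posCone n) :
    x = 0 := by
  rcases posCone_dotProduct hx strictDom_rho with h | h
  · exact h
  · rcases posCone_dotProduct hx' strictDom_rho with h' | h'
    · simpa using h'
    · rw [dotProduct_neg] at h'; omega

/-- The difference of the norms is (μ+ν, μ-ν), which is positive as soon as μ-ν is a nonzero sum of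
positive roots. -/
theorem StrictDom.eq_of_norm_eq {n : ℕ} {μ ν : Fin n → ℤ} (hμ : StrictDom μ) (hν : StrictDom ν)
    (h : μ - ν ∈ posCone n) (hn : μ ⬝ᵥ μ = ν ⬝ᵥ ν) : ν = μ := by
  rcases posCone_dotProduct h (hμ.add hν) with h' | h'
  · exact (sub_eq_zero.1 h').symm
  · rw [add_dotProduct, dotProduct_sub, dotProduct_sub, dotProduct_comm ν μ] at h'
    omega

/-- The orthogonal reflection in the root `wt a - wt b`. -/
def refl {n : ℕ} (a b : Fin n ⊕ Fin n) (ν : Fin n → ℤ) : Fin n → ℤ :=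
  ν - (ν ⬝ᵥ (wt a - wt b)) • (wt a - wt b)

/-! ### Alternating elements -/

/-- The elements that every reflection in a root `wt a - wt b` multiplies by `-1`. -/
def IsAlt {n : ℕ} (f : CExp n) : Prop :=
  ∀ a b : Fin n ⊕ Fin n, b ≠ a → b ≠ a.swap → ∀ ν, f.coeff (refl a b ν) = -f.coeff ν

theorem IsAlt.add {n : ℕ} {f g : CExp n} (hf : IsAlt f) (hg : IsAlt g) : IsAlt (f + g) := by
  intro a b h h' ν
  simp only [AddMonoidAlgebra.coeff_add, Finsupp.add_apply, hf a b h h', hg a b h h']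
  ring

theorem IsAlt.smul {n : ℕ} {f : CExp n} (hf : IsAlt f) (c : ℂ) : IsAlt (c • f) := by
  intro a b h h' ν
  simp [hf a b h h']

/-- An exponent of maximal ρ-height cannot be raised by a reflection, so it is dominant. It lies on
no wall, because a coefficient at an exponent fixed by a reflection equals its own negative. -/
theorem IsAlt.eq_zero {n : ℕ} {f : CExp n} (hf : IsAlt f)
    (h : ∀ ν, StrictDom ν → f.coeff ν = 0) : f = 0 := by
  by_contra hne
  have hsupp : f.coeff.support.Nonempty := by
    rw [Finsupp.support_nonempty_iff]
    intro h0
    exact hne (AddMonoidAlgebra.coeff_inj.1 h0)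
  obtain ⟨ν, hν, hmax⟩ := f.coeff.support.exists_max_image (fun ν => rho ⬝ᵥ ν) hsupp
  rw [Finsupp.mem_support_iff] at hν
  refine hν (h ν fun a b hab hab' => ?_)
  have hne' : b ≠ a := by rintro rfl; exact lt_irrefl _ hab
  have hr := hf a b hne' hab' ν
  have hle := hmax (refl a b ν) (by rw [Finsupp.mem_support_iff, hr]; simpa using hν)
  simp only [refl, dotProduct_sub, dotProduct_smul, smul_eq_mul] at hle
  have h1 : ν ⬝ᵥ wt b ≤ ν ⬝ᵥ wt a := by
    by_contra! hlt
    nlinarith [mul_pos (sub_pos.2 hlt) (sub_pos.2 hab)]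
  refine lt_of_le_of_ne h1 fun heq => hν ?_
  have hfix : refl a b ν = ν := by simp [refl, dotProduct_sub, heq]
  rw [hfix] at hr
  exact self_eq_neg.1 hr

/-! ### Elements supported below a weight -/

/-- The elements all of whose exponents lie in `ν₀ - posCone`. -/
def LowerBy {n : ℕ} (ν₀ : Fin n → ℤ) (f : CExp n) : Prop :=
  ∀ ν, f.coeff ν ≠ 0 → ν₀ - ν ∈ posCone n

theorem LowerBy.mul {n : ℕ} {μ ν : Fin n → ℤ} {f g : CExp n} (hf : LowerBy μ f)
    (hg : LowerBy ν g) : LowerBy (μ + ν) (f * g) := by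
  intro κ h
  rw [AddMonoidAlgebra.coeff_mul_apply_left] at h
  obtain ⟨z, -, hz⟩ := Finset.exists_ne_zero_of_sum_ne_zero h
  have h1 := hf z (left_ne_zero_of_mul hz)
  have h2 := hg _ (right_ne_zero_of_mul hz)
  convert add_mem h1 h2 using 1
  abel

/-- Leading coefficients multiply because the cone of positive roots contains no line. -/
theorem LowerBy.coeff_mul {n : ℕ} {μ ν : Fin n → ℤ} {f g : CExp n} (hf : LowerBy μ f)
    (hg : LowerBy ν g) : (f * g).coeff (μ + ν) = f.coeff μ * g.coeff ν := by
  rw [AddMonoidAlgebra.coeff_mul_apply_left, Finsupp.sum, Finset.sum_eq_single μ]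
  · simp
  · intro z _ hz
    by_contra h0
    have h1 := hf z (left_ne_zero_of_mul h0)
    have h2 := hg _ (right_ne_zero_of_mul h0)
    refine hz (sub_eq_zero.1 (posCone_antisymm h1 ?_)).symm
    convert h2 using 1
    abel
  · intro h
    rw [Finsupp.notMem_support_iff.1 h, zero_mul]

theorem LowerBy.sub {n : ℕ} {μ : Fin n → ℤ} {f g : CExp n} (hf : LowerBy μ f)
    (hg : LowerBy μ g) : LowerBy μ (f - g) := by
  intro ν h
  by_cases h0 : f.coeff ν = 0
  · refine hg ν fun h1 => h ?_
    simp [h0, h1]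
  · exact hf ν h0

theorem LowerBy.add {n : ℕ} {μ : Fin n → ℤ} {f g : CExp n} (hf : LowerBy μ f)
    (hg : LowerBy μ g) : LowerBy μ (f + g) := by
  intro ν h
  by_cases h0 : f.coeff ν = 0
  · refine hg ν fun h1 => h ?_
    simp [h0, h1]
  · exact hf ν h0

theorem lowerBy_mono {n : ℕ} {μ ν : Fin n → ℤ} (h : μ - ν ∈ posCone n) :
    LowerBy μ (mono ν) := by
  intro κ hκ
  rw [coeff_mono] at hκ
  split_ifs at hκ with h'
  · exact h' ▸ h
  · exact absurd rfl hκ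

theorem LowerBy.prod {n : ℕ} {ι : Type*} {s : Finset ι} {μ : ι → Fin n → ℤ} {f : ι → CExp n}
    (h : ∀ i ∈ s, LowerBy (μ i) (f i)) : LowerBy (∑ i ∈ s, μ i) (∏ i ∈ s, f i) := by
  classical
  induction s using Finset.induction_on with
  | empty =>
    rw [Finset.sum_empty, Finset.prod_empty, ← mono_zero]
    exact lowerBy_mono (by simp)
  | insert i s hi ih =>
    rw [Finset.sum_insert hi, Finset.prod_insert hi]
    exact (h i (Finset.mem_insert_self i s)).mul
      (ih fun j hj => h j (Finset.mem_insert_of_mem hj))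

end TypeD

end

noncomputable section

namespace TypeD

/-! ### Alternants -/

/-- The sum `e^{ε_i} + e^{-ε_i}`. -/
def yElt {n : ℕ} (i : Fin n) : CExp n := mono (wt (.inl i)) + mono (wt (.inr i))

/-- The determinant of the matrix with entries `e^{m_c ε_i} + e^{-m_c ε_i}`. -/
def alternant {n : ℕ} (m : Fin n → ℤ) : CExp n :=
  (Matrix.of fun i c : Fin n => (mono (Pi.single i (m c)) + mono (Pi.single i (-m c)) : CExp n)).det

theorem prod_mono {n : ℕ} {ι : Type*} (s : Finset ι) (μ : ι → Fin n → ℤ) :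
    ∏ i ∈ s, mono (μ i) = mono (∑ i ∈ s, μ i) := by
  classical
  induction s using Finset.induction_on with
  | empty => simp [mono_zero]
  | insert i s hi ih => rw [Finset.prod_insert hi, Finset.sum_insert hi, ih, mono_mul]

/-- The signs s range over all of {±1}^n, whereas the Weyl group of type D allows only an even
number of -1. The alternant is thus the sum of the type D alternants of m and of m with one sign
flipped, the source of every factor 2 below. -/
theorem alternant_eq_sum {n : ℕ} (m : Fin n → ℤ) :
    alternant m = ∑ σ : Equiv.Perm (Fin n), ∑ s : Fin n → ℤˣ,
      Equiv.Perm.sign σ • mono (∑ i, Pi.single (σ i) ((s i : ℤ) * m i)) := by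
  rw [alternant, Matrix.det_apply]
  refine Finset.sum_congr rfl fun σ _ => ?_
  rw [← Finset.smul_sum]
  congr 1
  have h : ∀ i, (mono (Pi.single (σ i) (m i)) + mono (Pi.single (σ i) (-m i)) : CExp n) =
      ∑ t : ℤˣ, mono (Pi.single (σ i) ((t : ℤ) * m i)) := by
    intro i
    rw [UnitsInt.univ, Finset.sum_pair (by decide)]
    simp
  simp only [Matrix.of_apply, h]
  rw [Finset.prod_univ_sum, Fintype.piFinset_univ]
  exact Finset.sum_congr rfl fun s _ => prod_mono _ _

theorem sum_single_perm_eq_iff {n : ℕ} (σ : Equiv.Perm (Fin n)) (f ν : Fin n → ℤ) :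
    ∑ i, Pi.single (σ i) (f i) = ν ↔ ∀ i, ν (σ i) = f i := by
  have h : ∀ j, (∑ i, Pi.single (σ i) (f i) : Fin n → ℤ) (σ j) = f j := by
    intro j
    rw [Finset.sum_apply, Finset.sum_eq_single j]
    · simp
    · intro i _ hij
      exact Pi.single_eq_of_ne (fun h => hij (σ.injective h.symm)) _
    · simp
  constructor
  · rintro rfl i; exact h i
  · intro h'
    ext j
    obtain ⟨i, rfl⟩ := σ.surjective j
    rw [h, h']

theorem coeff_alternant {n : ℕ} (m ν : Fin n → ℤ) :
    (alternant m).coeff ν = ∑ σ : Equiv.Perm (Fin n), ∑ s : Fin n → ℤˣ,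
      if ∀ i, ν (σ i) = (s i : ℤ) * m i then ((Equiv.Perm.sign σ : ℤ) : ℂ) else 0 := by
  simp only [alternant_eq_sum, AddMonoidAlgebra.coeff_sum, Finsupp.finsetSum_apply]
  refine Finset.sum_congr rfl fun σ _ => Finset.sum_congr rfl fun s _ => ?_
  simp only [← sum_single_perm_eq_iff]
  rcases Int.units_eq_one_or (Equiv.Perm.sign σ) with h | h <;> rw [h] <;>
    simp [Units.smul_def, coeff_mono, apply_ite]

theorem alternant_norm {n : ℕ} {m ν : Fin n → ℤ} (h : (alternant m).coeff ν ≠ 0) :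
    ν ⬝ᵥ ν = m ⬝ᵥ m := by
  rw [coeff_alternant] at h
  obtain ⟨σ, -, h⟩ := Finset.exists_ne_zero_of_sum_ne_zero h
  obtain ⟨s, -, h⟩ := Finset.exists_ne_zero_of_sum_ne_zero h
  rw [ite_ne_right_iff] at h
  rw [dotProduct, ← Equiv.sum_comp σ]
  refine Finset.sum_congr rfl fun i _ => ?_
  rw [h.1]
  rcases Int.units_eq_one_or (s i) with h | h <;> rw [h] <;> simp

/-- The reflection in ε_i - ε_j swaps two coordinates; the one in ε_i + ε_j also negates both. -/
theorem refl_eq {n : ℕ} {a b : Fin n ⊕ Fin n} (h : b ≠ a) (h' : b ≠ a.swap) :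
    ∃ i j : Fin n, i ≠ j ∧ ∃ t : Fin n → ℤˣ, ∀ (ν : Fin n → ℤ) (k : Fin n),
      refl a b ν (Equiv.swap i j k) = (t k : ℤ) * ν k := by
  have key : ∀ (i j : Fin n), i ≠ j → ∀ (u : ℤˣ) (ν : Fin n → ℤ) (k : Fin n),
      (ν - (ν i - u * ν j) • (Pi.single i 1 - (u : ℤ) • Pi.single j 1 : Fin n → ℤ))
        (Equiv.swap i j k) =
        ((if k = i ∨ k = j then u else 1 : ℤˣ) : ℤ) * ν k := by
    intro i j hij u ν k
    by_cases hi : k = i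
    · subst hi
      rcases Int.units_eq_one_or u with rfl | rfl <;> simp [hij]
    · by_cases hj : k = j
      · subst hj
        rcases Int.units_eq_one_or u with rfl | rfl <;> simp [hij]
      · rw [Equiv.swap_apply_of_ne_of_ne hi hj]
        simp [hi, hj]
  rcases a with i | i <;> rcases b with j | j <;> simp at h h'
  · refine ⟨i, j, Ne.symm h, fun k => if k = i ∨ k = j then 1 else 1, fun ν k => ?_⟩
    rw [← key i j (Ne.symm h) 1 ν k]; simp [refl, dotProduct_sub]
  · refine ⟨i, j, Ne.symm h', fun k => if k = i ∨ k = j then -1 else 1, fun ν k => ?_⟩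
    rw [← key i j (Ne.symm h') (-1) ν k]; simp [refl, dotProduct_add]
  · refine ⟨i, j, Ne.symm h', fun k => if k = i ∨ k = j then -1 else 1, fun ν k => ?_⟩
    rw [← key i j (Ne.symm h') (-1) ν k]
    simp [refl, dotProduct_sub]; ring
  · refine ⟨i, j, Ne.symm h, fun k => if k = i ∨ k = j then 1 else 1, fun ν k => ?_⟩
    rw [← key i j (Ne.symm h) 1 ν k]
    simp [refl]; ring

/-- A reflection permutes the index pairs (σ, s) and changes only the sign of σ. -/
theorem isAlt_alternant {n : ℕ} (m : Fin n → ℤ) : IsAlt (alternant m) := by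
  intro a b h h' ν
  obtain ⟨i, j, hij, t, ht⟩ := refl_eq h h'
  rw [coeff_alternant, coeff_alternant, ← Finset.sum_neg_distrib,
    ← Equiv.sum_comp (Equiv.mulLeft (Equiv.swap i j))]
  refine Finset.sum_congr rfl fun σ _ => ?_
  rw [← Finset.sum_neg_distrib,
    ← Equiv.sum_comp (Equiv.mulLeft (fun k => t (σ k) : Fin n → ℤˣ))]
  refine Finset.sum_congr rfl fun s _ => ?_
  have hu : ∀ k, ((t (σ k) : ℤ) * ν (σ k) = (t (σ k) : ℤ) * s k * m k) ↔ ν (σ k) = s k * m k := by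
    intro k
    rw [mul_assoc]
    exact mul_right_inj' (t (σ k)).ne_zero
  simp only [Equiv.coe_mulLeft, Equiv.Perm.coe_mul, Function.comp_apply, ht, Pi.mul_apply,
    Units.val_mul, hu, Equiv.Perm.sign_mul, Equiv.Perm.sign_swap hij]
  split_ifs <;> simp

theorem perm_eq_one_of_strictAnti {n : ℕ} {f g : Fin n → ℤ} (hf : StrictAnti f)
    (hg : StrictAnti g) {σ : Equiv.Perm (Fin n)} (h : ∀ i, f (σ i) = g i) : σ = 1 := by
  have hmono : StrictMono σ := by
    intro i j hij
    by_contra! hle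
    have := hg hij
    rw [← h, ← h] at this
    exact absurd (hf.antitone hle) (not_le.2 this)
  have := (hmono.range_inj strictMono_id).1 (by simp)
  exact Equiv.ext fun i => congrFun this i

theorem StrictDom.strictAnti_abs {n : ℕ} {ν : Fin n → ℤ} (hν : StrictDom ν) :
    StrictAnti fun i => |ν i| := fun _ _ h => (hν.abs_lt h).trans_le (le_abs_self _)

/-- Absolute values of the coordinates decrease strictly on both sides, which leaves no room for a
permutation. -/
theorem coeff_alternant_of_strictDom {n : ℕ} {m ν : Fin n → ℤ} (hm : StrictDom m)
    (hν : StrictDom ν) : (alternant m).coeff ν =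
      ∑ s : Fin n → ℤˣ, if ∀ i, ν i = (s i : ℤ) * m i then (1 : ℂ) else 0 := by
  rw [coeff_alternant, Finset.sum_eq_single 1]
  · simp
  · intro σ _ hσ
    refine Finset.sum_eq_zero fun s _ => if_neg fun h => hσ ?_
    refine perm_eq_one_of_strictAnti hν.strictAnti_abs hm.strictAnti_abs (σ := σ) fun i => ?_
    rw [h, abs_mul]
    rcases Int.units_eq_one_or (s i) with h | h <;> rw [h] <;> simp
  · simp

/-- A vector of signs is trivial on the positive coordinates that it fixes. -/
theorem units_eq_one_of_pos {u : ℤˣ} {x y : ℤ} (hx : 0 < x) (hy : 0 < y) (h : x = u * y) :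
    u = 1 := by
  rcases Int.units_eq_one_or u with rfl | rfl
  · rfl
  · simp at h; omega

/-- All coordinates before the last are positive and fix their signs. The sign of the zero
coordinate is free, hence the coefficient 2. -/
theorem coeff_alternant_of_last_eq_zero {n : ℕ} {m ν : Fin (n + 1) → ℤ} (hm : StrictDom m)
    (hν : StrictDom ν) (h0 : m (Fin.last n) = 0) :
    (alternant m).coeff ν = if ν = m then 2 else 0 := by
  have hpos : ∀ {μ : Fin (n + 1) → ℤ}, StrictDom μ → ∀ i : Fin n, 0 < μ i.castSucc :=
    fun hμ i => (abs_nonneg _).trans_lt (hμ.abs_lt (Fin.castSucc_lt_last i))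
  rw [coeff_alternant_of_strictDom hm hν]
  split_ifs with h
  · subst h
    have : ∀ s : Fin (n + 1) → ℤˣ, (∀ i, ν i = (s i : ℤ) * ν i) ↔
        s ∈ ({1, Function.update (1 : Fin (n + 1) → ℤˣ) (Fin.last n) (-1)} : Finset (Fin (n + 1) → ℤˣ)) := by
      intro s
      have hs : ∀ i : Fin n, ν i.castSucc = (s i.castSucc : ℤ) * ν i.castSucc ↔
          s i.castSucc = 1 := fun i =>
        ⟨units_eq_one_of_pos (hpos hν i) (hpos hν i), fun h => by simp [h]⟩
      rw [Fin.forall_fin_succ', h0]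
      simp only [hs, mul_zero, and_true, Finset.mem_insert, Finset.mem_singleton]
      constructor
      · intro h
        rcases Int.units_eq_one_or (s (Fin.last n)) with hl | hl
        · left
          funext i
          induction i using Fin.lastCases with
          | last => exact hl
          | cast i => exact h i
        · right
          funext i
          induction i using Fin.lastCases with
          | last => simpa using hl
          | cast i => rw [h i, Function.update_of_ne (Fin.castSucc_lt_last i).ne]; rfl
      · rintro (rfl | rfl) i
        · rfl
        · rw [Function.update_of_ne (Fin.castSucc_lt_last i).ne]; rfl
    simp only [this, Finset.sum_ite_mem, Finset.univ_inter]
    rw [Finset.sum_pair]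
    · norm_num
    · intro h
      have := congrFun h (Fin.last n)
      simp at this
  · refine Finset.sum_eq_zero fun s _ => if_neg fun hs => h ?_
    funext i
    induction i using Fin.lastCases with
    | last => rw [hs, h0, mul_zero]
    | cast i =>
      rw [hs, units_eq_one_of_pos (hpos hν i) (hpos hm i) (hs _)]
      simp

/-- Here the free last sign yields two different strictly dominant exponents, each met once. -/
theorem coeff_alternant_of_last_ne_zero {n : ℕ} {m ν : Fin (n + 1) → ℤ} (hm : StrictDom m)
    (hν : StrictDom ν) (h0 : m (Fin.last n) ≠ 0) :
    (alternant m).coeff ν =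
      if ν = m ∨ ν = Function.update m (Fin.last n) (-m (Fin.last n)) then 1 else 0 := by
  have hpos : ∀ {μ : Fin (n + 1) → ℤ}, StrictDom μ → ∀ i : Fin n, 0 < μ i.castSucc :=
    fun hμ i => (abs_nonneg _).trans_lt (hμ.abs_lt (Fin.castSucc_lt_last i))
  rw [coeff_alternant_of_strictDom hm hν]
  have hunit : ∀ (u : ℤˣ) {x : ℤ}, x ≠ 0 → (x = u * x ↔ u = 1) := by
    intro u x hx
    rcases Int.units_eq_one_or u with rfl | rfl
    · simp
    · simp only [Units.val_neg, Units.val_one, neg_mul, one_mul]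
      constructor
      · intro h; omega
      · intro h; exact absurd h (by decide)
  have hunit' : ∀ (u : ℤˣ) {x : ℤ}, x ≠ 0 → (-x = u * x ↔ u = -1) := by
    intro u x hx
    rcases Int.units_eq_one_or u with rfl | rfl
    · simp only [Units.val_one, one_mul]
      constructor
      · intro h; omega
      · intro h; exact absurd h (by decide)
    · simp
  have hm0 : ∀ i, m i ≠ 0 := by
    intro i
    induction i using Fin.lastCases with
    | last => exact h0
    | cast i => exact (hpos hm i).ne'
  split_ifs with h
  · rcases h with rfl | rfl
    · rw [Finset.sum_eq_single 1]
      · simp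
      · intro s _ hs
        refine if_neg fun h => hs (funext fun i => (hunit (s i) (hm0 i)).1 (h i))
      · simp
    · rw [Finset.sum_eq_single (Function.update (1 : Fin (n + 1) → ℤˣ) (Fin.last n) (-1))]
      · rw [if_pos]
        intro i
        by_cases hi : i = Fin.last n
        · subst hi; simp
        · simp [hi]
      · intro s _ hs
        refine if_neg fun h => hs (funext fun i => ?_)
        have hi' := h i
        by_cases hi : i = Fin.last n
        · subst hi
          simp only [Function.update_self] at hi' ⊢
          exact (hunit' _ h0).1 hi'
        · simp only [Function.update_of_ne hi] at hi' ⊢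
          exact (hunit _ (hm0 i)).1 hi'
      · simp
  · refine Finset.sum_eq_zero fun s _ => if_neg fun hs => h ?_
    have hc : ∀ i : Fin n, ν i.castSucc = m i.castSucc := by
      intro i
      rw [hs, units_eq_one_of_pos (hpos hν i) (hpos hm i) (hs _)]
      simp
    rcases Int.units_eq_one_or (s (Fin.last n)) with hl | hl
    · left
      funext i
      induction i using Fin.lastCases with
      | last => rw [hs, hl]; simp
      | cast i => exact hc i
    · right
      funext i
      induction i using Fin.lastCases with
      | last => rw [hs, hl]; simp
      | cast i => rw [Function.update_of_ne (Fin.castSucc_lt_last i).ne]; exact hc i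

/-! ### The Weyl denominator -/

theorem mono_single_nsmul {n : ℕ} (a : Fin n ⊕ Fin n) (k : ℕ) : mono (wt a) ^ k =
    mono (k • wt a) := by
  induction k with
  | zero => simp [mono_zero]
  | succ k ih => rw [pow_succ, ih, mono_mul, succ_nsmul]

/-- Column c holds the Chebyshev polynomial of degree ρ_c in the y_i, so the determinant is a
Vandermonde determinant up to a constant. The constant need not be evaluated: `coeff_alternant_rho`
finds the leading coefficient separately. -/
theorem alternant_rho_eq {n : ℕ} : ∃ κ : ℂ, alternant (rho : Fin n → ℤ) =
    algebraMap ℂ (CExp n) κ * ∏ i, ∏ j ∈ Finset.Ioi i, (yElt j - yElt i) := by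
  set p : Fin n → Polynomial (CExp n) := fun j => Polynomial.Chebyshev.C (CExp n) (j : ℕ)
  set c : Matrix (Fin n) (Fin n) ℂ :=
    Matrix.of fun i j : Fin n => (Polynomial.Chebyshev.C ℂ ((j : ℕ) : ℤ)).coeff i with hc
  refine ⟨Equiv.Perm.sign (Fin.revPerm : Equiv.Perm (Fin n)) * c.det, ?_⟩
  have h1 := Matrix.eval_matrixOfPolynomials_eq_vandermonde_mul_matrixOfPolynomials
    (yElt : Fin n → CExp n) p fun j => chebyshev_C_natDegree_le _ _
  have h2 : (Matrix.of fun i j : Fin n => (p j).coeff i) = (algebraMap ℂ (CExp n)).mapMatrix c := by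
    ext1 i j
    simp only [p, hc, RingHom.mapMatrix_apply, Matrix.map_apply, Matrix.of_apply]
    rw [← Polynomial.Chebyshev.map_C (algebraMap ℂ (CExp n)), Polynomial.coeff_map]
  have h3 : alternant (rho : Fin n → ℤ) =
      ((Matrix.of fun i j : Fin n => (p j).eval (yElt i)).submatrix id Fin.revPerm).det := by
    rw [alternant]
    congr 1
    ext1 i j
    have hy : (mono (wt (.inl i)) : CExp n) * mono (wt (.inr i)) = 1 := by
      rw [mono_mul, ← mono_zero]; simp
    have hj := j.2
    have hr : (rho j : ℤ) = ((Fin.rev j : Fin n) : ℕ) := by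
      rw [Fin.val_rev]; simp only [rho]; omega
    simp only [Matrix.of_apply, Matrix.submatrix_apply, id_eq, p, yElt, Fin.revPerm_apply]
    rw [chebyshev_C_eval_add hy, mono_single_nsmul, mono_single_nsmul, hr]
    congr 2 <;> ext k <;> by_cases hk : k = i <;> simp [hk]
  rw [h3, Matrix.det_permute', h1, h2, Matrix.det_mul, Matrix.det_vandermonde, ← RingHom.map_det,
    map_mul]
  simp only [map_intCast]
  ring

/-- The factor y_j - y_i with i < j has all exponents below ε_i, and ε_i is counted once for each j
> i, which adds up to ρ. -/
theorem lowerBy_alternant_rho {n : ℕ} : LowerBy rho (alternant (rho : Fin n → ℤ)) := by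
  obtain ⟨κ, hκ⟩ := alternant_rho_eq (n := n)
  have h1 : LowerBy (∑ i : Fin n, ∑ j ∈ Finset.Ioi i, wt (.inl i))
      (∏ i : Fin n, ∏ j ∈ Finset.Ioi i, (yElt j - yElt i)) := by
    refine LowerBy.prod fun i _ => LowerBy.prod fun j hj => ?_
    have hij : i < j := Finset.mem_Ioi.1 hj
    have hlt : (i : ℕ) < j := hij
    have hi := i.2
    have hj := j.2
    have hsub : wt (.inl i) - wt (.inl j) ∈ posCone n :=
      AddSubmonoid.subset_closure ⟨.inl i, .inl j, by simp [rho]; omega, by simp, rfl⟩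
    have hadd : wt (.inl i) - wt (.inr j) ∈ posCone n :=
      AddSubmonoid.subset_closure ⟨.inl i, .inr j, by simp [rho]; omega,
        by simp; exact hij.ne', rfl⟩
    refine ((lowerBy_mono hsub).add (lowerBy_mono hadd)).sub
      ((lowerBy_mono (by simp)).add (lowerBy_mono ?_))
    -- The exponent -ε_i of y_i lies 2ε_i below ε_i; this is not a root but the sum of ε_i - ε_j and
    -- ε_i + ε_j.
    convert add_mem hsub hadd using 1
    simp
  have h2 : ∑ i : Fin n, ∑ j ∈ Finset.Ioi i, wt (.inl i) = (rho : Fin n → ℤ) := by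
    ext k
    have hk := k.2
    simp only [Finset.sum_const, Fin.card_Ioi, Finset.sum_apply, Pi.smul_apply, wt_inl,
      Pi.single_apply, smul_ite, smul_zero, Finset.sum_ite_eq, Finset.mem_univ, if_true, rho]
    rw [nsmul_eq_mul, mul_one]
    omega
  rw [hκ]
  have h3 : LowerBy 0 (algebraMap ℂ (CExp n) κ) := by
    intro ν hν
    by_cases h : ν = 0
    · simp [h]
    · exact absurd (by simp [AddMonoidAlgebra.coe_algebraMap, Ne.symm h]) hν
  have := h3.mul h1
  rwa [h2, zero_add] at this

end TypeD

end

/-! ### Structure of 𝔰𝔬_{2n} and of its highest weight modules -/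

noncomputable section

namespace TypeD

attribute [local instance 100] LieRing.ofAssociativeRing

/-! ### Root vectors of `𝔰𝔬_{2n}` -/

theorem mem_typeD_iff {n : ℕ} (A : Matrix (Fin n ⊕ Fin n) (Fin n ⊕ Fin n) ℂ) :
    A ∈ LieAlgebra.Orthogonal.typeD (Fin n) ℂ ↔ ∀ a b, A a b = -A b.swap a.swap := by
  have hJ : LieAlgebra.Orthogonal.JD (Fin n) ℂ =
      Matrix.of fun a b => if b = a.swap then 1 else 0 := by
    ext a b
    rcases a with a | a <;> rcases b with b | b <;>
      simp [LieAlgebra.Orthogonal.JD, Matrix.one_apply, eq_comm]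
  rw [LieAlgebra.Orthogonal.typeD, mem_skewAdjointMatricesLieSubalgebra,
    mem_skewAdjointMatricesSubmodule, Matrix.IsSkewAdjoint, Matrix.IsAdjointPair, hJ,
    ← Matrix.ext_iff]
  have h1 : ∀ a b : Fin n ⊕ Fin n, (A.transpose * Matrix.of fun a b : Fin n ⊕ Fin n =>
      if b = a.swap then (1 : ℂ) else 0) a b = A b.swap a := by
    intro a b
    rw [Matrix.mul_apply, Finset.sum_eq_single b.swap]
    · simp
    · intro c _ hc
      simp only [Matrix.of_apply, mul_ite, mul_one, mul_zero, ite_eq_right_iff]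
      rintro rfl
      simp at hc
    · simp
  have h2 : ∀ a b : Fin n ⊕ Fin n, ((Matrix.of fun a b : Fin n ⊕ Fin n =>
      if b = a.swap then (1 : ℂ) else 0) * -A) a b = -A a.swap b := by
    intro a b
    rw [Matrix.mul_apply, Finset.sum_eq_single a.swap]
    · simp
    · intro c _ hc
      simp [hc]
    · simp
  simp only [h1, h2]
  constructor
  · intro h a b
    have := h b a.swap
    simpa using this
  · intro h a b
    simpa using h b.swap a

/-- The element `E_{a,b} - E_{-b,-a}` of `𝔰𝔬_{2n}`. -/
def elt {n : ℕ} (a b : Fin n ⊕ Fin n) : so n :=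
  ⟨Matrix.single a b 1 - Matrix.single b.swap a.swap 1, by
    rw [mem_typeD_iff]
    intro c d
    simp only [Matrix.sub_apply, Matrix.single_apply, neg_sub]
    have h1 : (b.swap = c ∧ a.swap = d) ↔ (a = d.swap ∧ b = c.swap) := by
      rw [and_comm]
      exact and_congr ⟨fun h => by simp [← h], fun h => by simp [h]⟩
        ⟨fun h => by simp [← h], fun h => by simp [h]⟩
    have h2 : (b.swap = d.swap ∧ a.swap = c.swap) ↔ (a = c ∧ b = d) := by
      rw [and_comm, Sum.swap_leftInverse.injective.eq_iff, Sum.swap_leftInverse.injective.eq_iff]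
    simp only [h1, h2]⟩

theorem elt_swap {n : ℕ} (a b : Fin n ⊕ Fin n) : elt b.swap a.swap = -elt a b := by
  apply Subtype.ext
  simp [elt]

theorem cartan_eq {n : ℕ} (i : Fin n) : cartan i = elt (.inl i) (.inl i) := by
  apply Subtype.ext
  ext a b
  rcases a with a | a <;> rcases b with b | b <;>
    simp [cartan, blocks, elt, Matrix.single_apply]

theorem rootVecSub_eq {n : ℕ} (i j : Fin n) : rootVecSub i j = elt (.inl i) (.inl j) := by
  apply Subtype.ext
  ext a b
  rcases a with a | a <;> rcases b with b | b <;>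
    simp [rootVecSub, blocks, elt, Matrix.single_apply, and_comm]

theorem rootVecAdd_eq {n : ℕ} (i j : Fin n) : rootVecAdd i j = elt (.inl i) (.inr j) := by
  apply Subtype.ext
  ext a b
  rcases a with a | a <;> rcases b with b | b <;>
    simp [rootVecAdd, blocks, elt, Matrix.single_apply]

/-- By `elt_swap` the spanning family meets each root vector twice, up to sign; hence the factor 2.
-/
theorem two_smul_eq_sum_elt {n : ℕ} (x : so n) :
    (2 : ℂ) • x = ∑ a, ∑ b, (x : Matrix _ _ ℂ) a b • elt a b := by
  apply Subtype.ext
  have hx := (mem_typeD_iff _).1 x.2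
  ext c d
  simp only [SetLike.val_smul, AddSubmonoidClass.coe_finsetSum, elt, Matrix.smul_apply,
    Matrix.sum_apply, Matrix.sub_apply, smul_eq_mul, mul_sub, Finset.sum_sub_distrib]
  have h1 : ∑ a, ∑ b, (x : Matrix _ _ ℂ) a b * Matrix.single a b 1 c d =
      (x : Matrix _ _ ℂ) c d := by
    rw [Finset.sum_eq_single c, Finset.sum_eq_single d] <;>
      simp +contextual [Matrix.single_apply]
  have h2 : ∑ a : Fin n ⊕ Fin n, ∑ b : Fin n ⊕ Fin n,
      (x : Matrix _ _ ℂ) a b * Matrix.single b.swap a.swap 1 c d =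
      (x : Matrix _ _ ℂ) d.swap c.swap := by
    rw [Finset.sum_eq_single d.swap, Finset.sum_eq_single c.swap]
    · simp
    · intro b _ hb
      rw [Matrix.single_apply, if_neg, mul_zero]
      rintro ⟨rfl, -⟩
      simp at hb
    · simp
    · intro a _ ha
      refine Finset.sum_eq_zero fun b _ => ?_
      rw [Matrix.single_apply, if_neg, mul_zero]
      rintro ⟨-, rfl⟩
      simp at ha
    · simp
  rw [h1, h2, hx c d]
  ring

theorem lie_elt {n : ℕ} (a b c d : Fin n ⊕ Fin n) :
    ⁅elt a b, elt c d⁆ = (if b = c then elt a d else 0) - (if d = a then elt c b else 0) -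
      (if a.swap = c then elt b.swap d else 0) + if d = b.swap then elt c a.swap else 0 := by
  have hs : ∀ a b c d : Fin n ⊕ Fin n, (Matrix.single a b 1 * Matrix.single c d 1 :
      Matrix _ _ ℂ) = if b = c then Matrix.single a d 1 else 0 := by
    intro a b c d
    split_ifs with h
    · subst h; simp
    · exact Matrix.single_mul_single_of_ne _ _ _ _ h _
  have h1 : (b = d.swap) ↔ (d = b.swap) := ⟨fun h => by simp [h], fun h => by simp [h]⟩
  have h2 : (a.swap = d.swap) ↔ (d = a) := by
    rw [Sum.swap_leftInverse.injective.eq_iff, eq_comm]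
  have h3 : (c.swap = a) ↔ (a.swap = c) := ⟨fun h => by simp [← h], fun h => by simp [← h]⟩
  have h4 : (c.swap = b.swap) ↔ (b = c) := by
    rw [Sum.swap_leftInverse.injective.eq_iff, eq_comm]
  apply Subtype.ext
  rw [LieSubalgebra.coe_bracket, Ring.lie_def]
  simp only [elt, sub_mul, mul_sub, hs, h1, h2, h3, h4]
  split_ifs <;> simp <;> abel

/-! ### Generators of the enveloping algebra -/

/-- The element `E_{a,b} - E_{-b,-a}` in the enveloping algebra. -/
def gen {n : ℕ} (a b : Fin n ⊕ Fin n) : U n := toU (elt a b)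

theorem gen_swap {n : ℕ} (a b : Fin n ⊕ Fin n) : gen b.swap a.swap = -gen a b := by
  rw [gen, elt_swap, gen]
  exact map_neg _ _

theorem gen_self_swap {n : ℕ} (a : Fin n ⊕ Fin n) : gen a a.swap = 0 := by
  have h := gen_swap a a.swap
  rw [Sum.swap_swap] at h
  have h2 : (2 : ℂ) • gen a a.swap = 0 := by
    rw [two_smul]
    nth_rewrite 1 [h]
    exact neg_add_cancel _
  exact (smul_eq_zero.1 h2).resolve_left two_ne_zero

theorem gen_mul_gen {n : ℕ} (a b c d : Fin n ⊕ Fin n) :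
    gen a b * gen c d = gen c d * gen a b + ((if b = c then gen a d else 0) -
      (if d = a then gen c b else 0) - (if a.swap = c then gen b.swap d else 0) +
      if d = b.swap then gen c a.swap else 0) := by
  have h : toU ⁅elt a b, elt c d⁆ = gen a b * gen c d - gen c d * gen a b := by
    rw [toU, LieHom.map_lie, LieRing.of_associative_ring_bracket]
    rfl
  rw [lie_elt] at h
  rw [← sub_eq_iff_eq_add', ← h]
  simp only [gen, toU, map_add, map_sub, apply_ite (UniversalEnvelopingAlgebra.ι ℂ), map_zero]

theorem gen_mul_comm_of_ne {n : ℕ} {a b : Fin n ⊕ Fin n} (h' : b ≠ a.swap) :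
    gen a b * gen b a = gen b a * gen a b + (gen a a - gen b b) := by
  rw [gen_mul_gen, if_pos rfl, if_pos rfl, if_neg h'.symm, if_neg, sub_zero, add_zero]
  rintro h2
  exact h' (by simp [h2])

theorem cartan_mul_gen {n : ℕ} (i : Fin n) (a b : Fin n ⊕ Fin n) :
    gen (.inl i) (.inl i) * gen a b = gen a b * gen (.inl i) (.inl i) +
      ((wt a i - wt b i : ℤ) : ℂ) • gen a b := by
  rw [gen_mul_gen]
  congr 1
  rcases a with a | a <;> rcases b with b | b <;> obtain rfl | h1 := eq_or_ne i a <;>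
    obtain rfl | h2 := eq_or_ne i b <;>
    simp [*, Ne.symm, eq_comm] <;> module

/-- By the universal property the identity of the enveloping algebra factors through any subalgebra
that contains the generators. -/
theorem subalgebra_eq_top {n : ℕ} (S : Subalgebra ℂ (U n)) (h : ∀ a b, gen a b ∈ S) (u : U n) :
    u ∈ S := by
  have hx : ∀ x : so n, toU x ∈ S := by
    intro x
    have : toU x = (2⁻¹ : ℂ) • ∑ a, ∑ b, (x : Matrix _ _ ℂ) a b • (gen a b : U n) := by
      rw [eq_inv_smul_iff₀ two_ne_zero]
      have := congrArg toU (two_smul_eq_sum_elt x)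
      simpa only [toU, map_smul, map_sum] using! this
    rw [this]
    exact S.smul_mem (sum_mem fun a _ => sum_mem fun b _ => S.smul_mem (h a b) _) _
  let f : so n →ₗ⁅ℂ⁆ S :=
    { toFun := fun x => ⟨toU x, hx x⟩
      map_add' := fun x y => Subtype.ext (map_add _ _ _)
      map_smul' := fun c x => Subtype.ext (map_smul _ _ _)
      map_lie' := fun {x y} => Subtype.ext (LieHom.map_lie _ _ _) }
  have hcomp : S.val.comp (UniversalEnvelopingAlgebra.lift ℂ f) = AlgHom.id ℂ (U n) := by
    apply UniversalEnvelopingAlgebra.hom_ext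
    ext x
    have := UniversalEnvelopingAlgebra.lift_ι_apply ℂ f x
    change S.val (UniversalEnvelopingAlgebra.lift ℂ f (toU x)) = toU x
    rw [this]
    rfl
  have := DFunLike.congr_fun hcomp u
  rw [AlgHom.id_apply] at this
  rw [← this]
  exact ((UniversalEnvelopingAlgebra.lift ℂ f) u).2

theorem smul_mem_of_gen {n : ℕ} {V : Type*} [AddCommGroup V] [Module ℂ V] [Module (U n) V]
    [IsScalarTower ℂ (U n) V] (W : Submodule ℂ V)
    (h : ∀ a b, ∀ w ∈ W, (gen a b : U n) • w ∈ W) (u : U n) {w : V} (hw : w ∈ W) : u • w ∈ W := by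
  let S : Subalgebra ℂ (U n) :=
    { carrier := {u | ∀ w ∈ W, u • w ∈ W}
      mul_mem' := fun {x y} hx hy w hw => by rw [mul_smul]; exact hx _ (hy _ hw)
      add_mem' := fun {x y} hx hy w hw => by rw [add_smul]; exact W.add_mem (hx _ hw) (hy _ hw)
      algebraMap_mem' := fun c w hw => by rw [algebraMap_smul]; exact W.smul_mem c hw }
  exact subalgebra_eq_top S h u w hw

end TypeD

end

noncomputable section

namespace TypeD

/-! ### Weight spaces -/

section WeightSpaces

variable {n : ℕ} (V : Type*) [AddCommGroup V] [Module ℂ V] [Module (U n) V]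
  [IsScalarTower ℂ (U n) V]

/-- The weight space of weight `μ` of an `𝔰𝔬_{2n}`-module. -/
def wtSpace (μ : Fin n → ℤ) : Submodule ℂ V where
  carrier := {v | ∀ i, (gen (.inl i) (.inl i) : U n) • v = (μ i : ℂ) • v}
  zero_mem' := by intro i; simp
  add_mem' := by
    intro v w hv hw i
    rw [smul_add, smul_add, hv i, hw i]
  smul_mem' := by
    intro c v hv i
    rw [smul_comm, hv i, smul_comm]

variable {V}

theorem mem_wtSpace {μ : Fin n → ℤ} {v : V} :
    v ∈ wtSpace V μ ↔ ∀ i, (gen (.inl i) (.inl i) : U n) • v = (μ i : ℂ) • v := Iff.rfl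

theorem gen_self_smul {μ : Fin n → ℤ} {v : V} (hv : v ∈ wtSpace V μ) (a : Fin n ⊕ Fin n) :
    (gen a a : U n) • v = ((μ ⬝ᵥ wt a : ℤ) : ℂ) • v := by
  rcases a with i | i
  · simpa using hv i
  · have := gen_swap (n := n) (.inl i) (.inl i)
    rw [Sum.swap_inl] at this
    rw [this, neg_smul, hv i]
    simp

theorem gen_smul_mem {μ : Fin n → ℤ} {v : V} (hv : v ∈ wtSpace V μ) (a b : Fin n ⊕ Fin n) :
    (gen a b : U n) • v ∈ wtSpace V (μ + (wt a - wt b)) := by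
  intro i
  rw [← mul_smul, cartan_mul_gen, add_smul, mul_smul, hv i, smul_assoc, smul_comm, ← add_smul]
  simp

variable (V) in
-- Weight spaces lie in simultaneous generalized eigenspaces of commuting operators, and distinct
-- weights give distinct eigenvalue systems.
theorem iSupIndep_wtSpace : iSupIndep (wtSpace V : (Fin n → ℤ) → Submodule ℂ V) := by
  let f : Fin n → Module.End ℂ V := fun i => Algebra.lsmul ℂ ℂ V (gen (.inl i) (.inl i) : U n)
  have hcomm : ∀ i j, Commute (f i) (f j) := by
    intro i j
    have : (gen (.inl i) (.inl i) : U n) * gen (.inl j) (.inl j) =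
        gen (.inl j) (.inl j) * gen (.inl i) (.inl i) := by
      rw [cartan_mul_gen]; simp
    change f i * f j = f j * f i
    rw [← map_mul, this, map_mul]
  have h := Module.End.independent_iInf_maxGenEigenspace_of_forall_mapsTo f
    (fun i j φ => Module.End.mapsTo_maxGenEigenspace_of_comm (hcomm j i) φ)
  have hinj : Function.Injective fun (μ : Fin n → ℤ) (i : Fin n) => (μ i : ℂ) := by
    intro μ ν hμν
    funext i
    have := congrFun hμν i
    dsimp only at this
    exact_mod_cast this
  refine (h.comp hinj).mono fun μ v hv => ?_
  simp only [Function.comp_apply, Submodule.mem_iInf]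
  intro i
  refine Module.End.mem_maxGenEigenspace _ _ _ |>.2 ⟨1, ?_⟩
  rw [pow_one, LinearMap.sub_apply, LinearMap.smul_apply, Module.End.one_apply]
  exact sub_eq_zero.2 (hv i)

/-! ### Highest weight vectors -/

/-- Highest weight vectors of weight `lam`, possibly zero. -/
def IsHighest (lam : Fin n → ℤ) (v : V) : Prop :=
  v ∈ wtSpace V lam ∧
    ∀ a b : Fin n ⊕ Fin n, rho ⬝ᵥ wt b < rho ⬝ᵥ wt a → (gen a b : U n) • v = 0

/-- The vectors obtained from `v` by applying negative root vectors, with their weights. -/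
inductive IsWord (lam : Fin n → ℤ) (v : V) : (Fin n → ℤ) → V → Prop
  | base : IsWord lam v lam v
  | step {μ : Fin n → ℤ} {w : V} (a b : Fin n ⊕ Fin n) : IsWord lam v μ w →
      rho ⬝ᵥ wt a < rho ⬝ᵥ wt b → b ≠ a.swap →
      IsWord lam v (μ + (wt a - wt b)) ((gen a b : U n) • w)

theorem rho_wt_ne {a b : Fin n ⊕ Fin n} (h : b ≠ a) (h' : b ≠ a.swap) :
    rho ⬝ᵥ wt a ≠ rho ⬝ᵥ wt b := by
  rcases a with i | i <;> rcases b with j | j <;> simp [rho] at h h' ⊢ <;>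
    have hi := i.2 <;> have hj := j.2 <;> rw [Fin.ext_iff] at * <;> omega

variable {lam : Fin n → ℤ} {v : V}

theorem IsWord.mem_wtSpace (hv : IsHighest lam v) {μ : Fin n → ℤ} {w : V}
    (hw : IsWord lam v μ w) : w ∈ wtSpace V μ := by
  induction hw with
  | base => exact hv.1
  | step a b _ _ _ ih => exact gen_smul_mem ih a b

theorem IsWord.sub_mem_posCone {μ : Fin n → ℤ} {w : V} (hw : IsWord lam v μ w) :
    lam - μ ∈ posCone n := by
  induction hw with
  | base => simp
  | @step μ w a b _ h h' ih =>
    have : wt b - wt a ∈ posCone n := AddSubmonoid.subset_closure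
      ⟨b, a, h, fun h2 => h' (by simp [h2]), rfl⟩
    convert add_mem ih this using 1
    abel

theorem IsWord.eq_or_lt {μ : Fin n → ℤ} {w : V} (hw : IsWord lam v μ w) :
    (μ = lam ∧ w = v) ∨ rho ⬝ᵥ μ < rho ⬝ᵥ lam := by
  induction hw with
  | base => exact Or.inl ⟨rfl, rfl⟩
  | @step μ w a b _ h _ ih =>
    right
    have : rho ⬝ᵥ μ ≤ rho ⬝ᵥ lam := by
      rcases ih with ⟨rfl, -⟩ | ih
      · exact le_rfl
      · exact ih.le
    rw [dotProduct_add, dotProduct_sub]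
    omega

/-- The span of the words in the negative root vectors applied to `v`. -/
def wordSpan (lam : Fin n → ℤ) (v : V) : Submodule ℂ V :=
  Submodule.span ℂ {w | ∃ μ, IsWord lam v μ w}

theorem lower_smul_mem_wordSpan {a b : Fin n ⊕ Fin n} (h : rho ⬝ᵥ wt a < rho ⬝ᵥ wt b) {w : V}
    (hw : w ∈ wordSpan lam v) : (gen a b : U n) • w ∈ wordSpan lam v := by
  by_cases h' : b = a.swap
  · rw [h', gen_self_swap, zero_smul]
    exact zero_mem _
  induction hw using Submodule.span_induction with
  | mem w hw =>
    obtain ⟨μ, hw⟩ := hw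
    exact Submodule.subset_span ⟨_, hw.step a b h h'⟩
  | zero => rw [smul_zero]; exact zero_mem _
  | add x y _ _ hx hy => rw [smul_add]; exact add_mem hx hy
  | smul c x _ hx => rw [smul_comm]; exact Submodule.smul_mem _ _ hx

/-- Moving a generator past the first letter of a word leaves commutators that are again generators
acting on a shorter word. The induction therefore covers all generators at once, and no PBW basis is
needed. -/
theorem IsWord.gen_smul_mem_wordSpan (hv : IsHighest lam v) {μ : Fin n → ℤ} {w : V}
    (hw : IsWord lam v μ w) (c d : Fin n ⊕ Fin n) : (gen c d : U n) • w ∈ wordSpan lam v := by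
  induction hw generalizing c d with
  | base =>
    by_cases h : d = c.swap
    · rw [h, gen_self_swap, zero_smul]; exact zero_mem _
    by_cases h' : d = c
    · rw [h', gen_self_smul hv.1]
      exact Submodule.smul_mem _ _ (Submodule.subset_span ⟨_, .base⟩)
    rcases lt_or_gt_of_ne (rho_wt_ne h' h) with h | h
    · exact lower_smul_mem_wordSpan h (Submodule.subset_span ⟨_, .base⟩)
    · rw [hv.2 c d h]; exact zero_mem _
  | @step μ w a b _ h _ ih =>
    have hite : ∀ (P : Prop) [Decidable P] (x y : Fin n ⊕ Fin n),
        (if P then gen x y else 0 : U n) • w ∈ wordSpan lam v := by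
      intro P _ x y
      split_ifs
      · exact ih x y
      · rw [zero_smul]; exact zero_mem _
    rw [← mul_smul, gen_mul_gen, add_smul, mul_smul, add_smul, sub_smul, sub_smul]
    exact add_mem (lower_smul_mem_wordSpan h (ih c d))
      (add_mem (sub_mem (sub_mem (hite _ _ _) (hite _ _ _)) (hite _ _ _)) (hite _ _ _))

theorem wordSpan_eq_top (hv : IsHighest lam v) (hgen : ∀ w : V, ∃ u : U n, u • v = w) :
    wordSpan lam v = ⊤ := by
  rw [eq_top_iff]
  intro w _
  obtain ⟨u, rfl⟩ := hgen w
  refine smul_mem_of_gen _ (fun a b w hw => ?_) u (Submodule.subset_span ⟨_, .base⟩)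
  induction hw using Submodule.span_induction with
  | mem w hw =>
    obtain ⟨μ, hw⟩ := hw
    exact hw.gen_smul_mem_wordSpan hv a b
  | zero => rw [smul_zero]; exact zero_mem _
  | add x y _ _ hx hy => rw [smul_add]; exact add_mem hx hy
  | smul c x _ hx => rw [smul_comm]; exact Submodule.smul_mem _ _ hx

theorem iSup_wtSpace_eq_top (hv : IsHighest lam v) (hgen : ∀ w : V, ∃ u : U n, u • v = w) :
    ⨆ μ, wtSpace V (μ : Fin n → ℤ) = ⊤ := by
  rw [eq_top_iff, ← wordSpan_eq_top hv hgen, wordSpan, Submodule.span_le]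
  rintro w ⟨μ, hw⟩
  exact Submodule.mem_iSup_of_mem μ (hw.mem_wtSpace hv)

/-- A vector of weight ν is a combination of words; the part made of words of other weights must
vanish by independence of weight spaces. -/
theorem wtSpace_le_span (hv : IsHighest lam v) (hgen : ∀ w : V, ∃ u : U n, u • v = w)
    (ν : Fin n → ℤ) : wtSpace V ν ≤ Submodule.span ℂ {w | IsWord lam v ν w} := by
  intro w hw
  have htop : w ∈ Submodule.span ℂ {w | IsWord lam v ν w} ⊔ ⨆ μ, ⨆ _ : μ ≠ ν, wtSpace V μ := by
    have : w ∈ wordSpan lam v := by rw [wordSpan_eq_top hv hgen]; trivial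
    revert this
    apply Submodule.span_le.2
    rintro x ⟨μ, hx⟩
    by_cases h : μ = ν
    · subst h
      exact Submodule.mem_sup_left (Submodule.subset_span hx)
    · exact Submodule.mem_sup_right
        (Submodule.mem_iSup_of_mem μ (Submodule.mem_iSup_of_mem h (hx.mem_wtSpace hv)))
  obtain ⟨x, hx, y, hy, rfl⟩ := Submodule.mem_sup.1 htop
  have hx' : x ∈ wtSpace V ν := by
    refine Submodule.span_le.2 ?_ hx
    intro z hz
    exact IsWord.mem_wtSpace hv hz
  have hy' : y ∈ wtSpace V ν := by simpa using sub_mem hw hx'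
  have := (Submodule.disjoint_def.1 (iSupIndep_wtSpace V ν)) y hy' hy
  rwa [this, add_zero]

theorem sub_mem_posCone_of_wtSpace_ne_bot (hv : IsHighest lam v)
    (hgen : ∀ w : V, ∃ u : U n, u • v = w) {ν : Fin n → ℤ} (h : wtSpace V ν ≠ ⊥) :
    lam - ν ∈ posCone n := by
  have hne : {w : V | IsWord lam v ν w}.Nonempty := by
    by_contra hemp
    rw [Set.not_nonempty_iff_eq_empty] at hemp
    have := wtSpace_le_span hv hgen ν
    rw [hemp, Submodule.span_empty, le_bot_iff] at this
    exact h this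
  obtain ⟨w, hw⟩ := hne
  exact hw.sub_mem_posCone

theorem wtSpace_self_eq (hv : IsHighest lam v) (hgen : ∀ w : V, ∃ u : U n, u • v = w) :
    wtSpace V lam = Submodule.span ℂ {v} := by
  refine le_antisymm ((wtSpace_le_span hv hgen lam).trans (Submodule.span_mono ?_)) ?_
  · intro w hw
    rcases hw.eq_or_lt with h | h
    · exact h.2
    · exact absurd h (lt_irrefl _)
  · rw [Submodule.span_singleton_le_iff_mem]
    exact hv.1

/-! ### The largest proper submodule -/

/-- The element `∑_i ρ_i h_i` of the Cartan subalgebra. -/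
def rhoElt (n : ℕ) : U n := ∑ i, ((rho i : ℤ) : ℂ) • gen (.inl i) (.inl i)

theorem rhoElt_smul {μ : Fin n → ℤ} {w : V} (hw : w ∈ wtSpace V μ) :
    rhoElt n • w = ((rho ⬝ᵥ μ : ℤ) : ℂ) • w := by
  rw [rhoElt, Finset.sum_smul]
  simp only [smul_assoc, mem_wtSpace.1 hw]
  simp only [smul_smul, ← Finset.sum_smul, dotProduct]
  push_cast
  rfl

theorem aeval_rhoElt_smul {μ : Fin n → ℤ} {w : V} (hw : w ∈ wtSpace V μ) (P : Polynomial ℂ) :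
    Polynomial.aeval (rhoElt n) P • w = P.eval ((rho ⬝ᵥ μ : ℤ) : ℂ) • w := by
  induction P using Polynomial.induction_on' with
  | add p q hp hq => rw [map_add, add_smul, hp, hq, Polynomial.eval_add, add_smul]
  | monomial k c =>
    rw [Polynomial.aeval_monomial, mul_smul, algebraMap_smul, Polynomial.eval_monomial, mul_smul]
    congr 1
    induction k with
    | zero => simp
    | succ k ih =>
      rw [pow_succ, mul_smul, rhoElt_smul hw, smul_comm, ih, pow_succ, smul_smul, mul_comm]

/-- The span of the words of positive length. -/
def lowerSpan (lam : Fin n → ℤ) (v : V) : Submodule ℂ V :=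
  Submodule.span ℂ {w | ∃ μ, IsWord lam v μ w ∧ rho ⬝ᵥ μ < rho ⬝ᵥ lam}

/-- Polynomials in `rhoElt` separate the top weight from the lower ones: a product of factors X -
(ρ, μ) kills a given vector of `lowerSpan` but not v. -/
theorem exists_aeval_smul_eq_zero (hv : IsHighest lam v) {w : V} (hw : w ∈ lowerSpan lam v) :
    ∃ P : Polynomial ℂ, Polynomial.aeval (rhoElt n) P • w = 0 ∧
      P.eval ((rho ⬝ᵥ lam : ℤ) : ℂ) ≠ 0 := by
  induction hw using Submodule.span_induction with
  | mem w hw =>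
    obtain ⟨μ, hw, hlt⟩ := hw
    refine ⟨Polynomial.X - Polynomial.C ((rho ⬝ᵥ μ : ℤ) : ℂ), ?_, ?_⟩
    · rw [aeval_rhoElt_smul (hw.mem_wtSpace hv)]; simp
    · simp only [Polynomial.eval_sub, Polynomial.eval_X, Polynomial.eval_C, sub_ne_zero]
      exact_mod_cast hlt.ne'
  | zero => exact ⟨1, by simp, by simp⟩
  | add x y _ _ hx hy =>
    obtain ⟨P, hP, hP'⟩ := hx
    obtain ⟨Q, hQ, hQ'⟩ := hy
    refine ⟨P * Q, ?_, by rw [Polynomial.eval_mul]; exact mul_ne_zero hP' hQ'⟩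
    rw [smul_add]
    nth_rewrite 1 [mul_comm]
    rw [map_mul, map_mul, mul_smul, mul_smul, hP, hQ, smul_zero, smul_zero, add_zero]
  | smul c x _ hx =>
    obtain ⟨P, hP, hP'⟩ := hx
    exact ⟨P, by rw [smul_comm, hP, smul_zero], hP'⟩

theorem exists_add_mem_lowerSpan (hv : IsHighest lam v) (hgen : ∀ w : V, ∃ u : U n, u • v = w)
    (w : V) : ∃ c : ℂ, w - c • v ∈ lowerSpan lam v := by
  have hw : w ∈ wordSpan lam v := by rw [wordSpan_eq_top hv hgen]; trivial
  induction hw using Submodule.span_induction with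
  | mem w hw =>
    obtain ⟨μ, hw⟩ := hw
    rcases hw.eq_or_lt with ⟨rfl, rfl⟩ | h
    · exact ⟨1, by simp⟩
    · refine ⟨0, ?_⟩
      rw [zero_smul, sub_zero]
      exact Submodule.subset_span ⟨μ, hw, h⟩
  | zero => exact ⟨0, by simp⟩
  | add x y _ _ hx hy =>
    obtain ⟨c, hc⟩ := hx
    obtain ⟨d, hd⟩ := hy
    refine ⟨c + d, ?_⟩
    convert add_mem hc hd using 1
    module
  | smul d x _ hx =>
    obtain ⟨c, hc⟩ := hx
    refine ⟨d * c, ?_⟩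
    convert Submodule.smul_mem _ d hc using 1
    module

/-- If w had a nonzero v-component, a polynomial in `rhoElt` would turn w into a nonzero multiple of
v inside I. -/
theorem le_lowerSpan_of_notMem (hv : IsHighest lam v) (hgen : ∀ w : V, ∃ u : U n, u • v = w)
    {I : Submodule (U n) V} (hI : v ∉ I) {w : V} (hw : w ∈ I) : w ∈ lowerSpan lam v := by
  obtain ⟨c, hc⟩ := exists_add_mem_lowerSpan hv hgen w
  by_cases hc0 : c = 0
  · simpa [hc0] using hc
  obtain ⟨P, hP, hP'⟩ := exists_aeval_smul_eq_zero hv hc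
  rw [smul_sub, sub_eq_zero, smul_comm, aeval_rhoElt_smul hv.1, smul_smul] at hP
  have h1 : (c * P.eval ((rho ⬝ᵥ lam : ℤ) : ℂ)) • v ∈ I := hP ▸ I.smul_mem _ hw
  rw [← algebraMap_smul (U n)] at h1
  have h2 := I.smul_mem (algebraMap ℂ (U n) (c * P.eval ((rho ⬝ᵥ lam : ℤ) : ℂ))⁻¹) h1
  rw [smul_smul, ← map_mul, inv_mul_cancel₀ (mul_ne_zero hc0 hP'), map_one, one_smul] at h2
  exact absurd h2 hI

theorem notMem_lowerSpan (hv : IsHighest lam v) (h0 : v ≠ 0) : v ∉ lowerSpan lam v := by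
  intro h
  obtain ⟨P, hP, hP'⟩ := exists_aeval_smul_eq_zero hv h
  rw [aeval_rhoElt_smul hv.1] at hP
  exact h0 ((smul_eq_zero.1 hP).resolve_left hP')

end WeightSpaces

theorem exists_smul_mkQ_one {n : ℕ} (I : Submodule (U n) (U n)) (w : U n ⧸ I) :
    ∃ u : U n, u • I.mkQ 1 = w := by
  obtain ⟨u, rfl⟩ := I.mkQ_surjective w
  exact ⟨u, by rw [← map_smul, smul_eq_mul, mul_one]⟩

theorem isHighest_mkQ_one {n : ℕ} {lam : Fin n → ℤ} {I : Submodule (U n) (U n)}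
    (h : vermaIdeal lam ≤ I) : IsHighest lam (I.mkQ 1) := by
  constructor
  · intro i
    have : toU (cartan i) - algebraMap ℂ (U n) (lam i : ℂ) ∈ I :=
      h (Submodule.subset_span (Or.inr ⟨i, rfl⟩))
    rw [cartan_eq] at this
    rw [← algebraMap_smul (U n) (lam i : ℂ), ← map_smul, ← map_smul, smul_eq_mul, smul_eq_mul,
      mul_one, mul_one, Submodule.mkQ_apply, Submodule.mkQ_apply, Submodule.Quotient.eq]
    exact this
  · have hsub : ∀ {i j : Fin n}, i < j → gen (.inl i) (.inl j) ∈ I := by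
      intro i j hij
      rw [gen, ← rootVecSub_eq]
      exact h (Submodule.subset_span (Or.inl ⟨i, j, hij, Or.inl rfl⟩))
    have hadd : ∀ {i j : Fin n}, i < j → gen (.inl i) (.inr j) ∈ I := by
      intro i j hij
      rw [gen, ← rootVecAdd_eq]
      exact h (Submodule.subset_span (Or.inl ⟨i, j, hij, Or.inr rfl⟩))
    intro a b hab
    rw [← map_smul, smul_eq_mul, mul_one, Submodule.mkQ_apply, Submodule.Quotient.mk_eq_zero]
    rcases a with i | i <;> rcases b with j | j
    · exact hsub (by simpa [rho] using hab)
    · rcases lt_trichotomy i j with hij | rfl | hij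
      · exact hadd hij
      · have := gen_self_swap (n := n) (.inl i)
        rw [Sum.swap_inl] at this
        rw [this]; exact zero_mem _
      · have := gen_swap (n := n) (.inl j) (.inr i)
        rw [Sum.swap_inr, Sum.swap_inl] at this
        rw [this]
        exact neg_mem (hadd hij)
    · exfalso
      simp [rho] at hab
      omega
    · have := gen_swap (n := n) (.inl j) (.inl i)
      rw [Sum.swap_inl, Sum.swap_inl] at this
      rw [this]
      exact neg_mem (hsub (by simpa [rho] using hab))

theorem vermaIdeal_le_maxIdeal {n : ℕ} {lam : Fin n → ℤ} (h : vermaIdeal lam ≠ ⊤) :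
    vermaIdeal lam ≤ maxIdeal lam := le_sSup ⟨le_rfl, h⟩

/-- In the Verma module all proper submodules lie in the one subspace `lowerSpan`, hence so does
their sum, which therefore misses the highest weight vector. -/
theorem maxIdeal_ne_top {n : ℕ} {lam : Fin n → ℤ} (h : vermaIdeal lam ≠ ⊤) :
    maxIdeal lam ≠ ⊤ := by
  intro htop
  set v := (vermaIdeal lam).mkQ 1 with hvdef
  have hv : IsHighest lam v := isHighest_mkQ_one le_rfl
  have hgen := exists_smul_mkQ_one (vermaIdeal lam)
  have h0 : v ≠ 0 := by
    rw [hvdef, Ne, Submodule.mkQ_apply, Submodule.Quotient.mk_eq_zero]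
    intro h1
    exact h ((Ideal.eq_top_iff_one (vermaIdeal lam)).2 h1)
  have h1 : (1 : U n) ∈ maxIdeal lam := by rw [htop]; trivial
  refine notMem_lowerSpan hv h0 ?_
  rw [maxIdeal, sSup_eq_iSup'] at h1
  rw [hvdef]
  refine Submodule.iSup_induction _ (motive := fun x => (vermaIdeal lam).mkQ x ∈ lowerSpan lam v)
    h1 ?_ (by simp) fun x y hx hy => by rw [map_add]; exact add_mem hx hy
  rintro ⟨I, hI, hI'⟩ x hx
  refine le_lowerSpan_of_notMem hv hgen (I := I.map (vermaIdeal lam).mkQ) ?_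
    (Submodule.mem_map_of_mem hx)
  rintro ⟨y, hy, hy'⟩
  rw [hvdef, Submodule.mkQ_apply, Submodule.mkQ_apply, Submodule.Quotient.eq] at hy'
  have : (1 : U n) ∈ I := by
    have := I.sub_mem hy (hI hy')
    rwa [sub_sub_cancel] at this
  exact hI' ((Ideal.eq_top_iff_one I).2 this)

end TypeD

end

noncomputable section

namespace TypeD

/-! ### Invariance of weight multiplicities under reflections -/

section Reflections

variable {n : ℕ} {V : Type*} [AddCommGroup V] [Module ℂ V] [Module (U n) V]
  [IsScalarTower ℂ (U n) V]

theorem root_dotProduct_self {a b : Fin n ⊕ Fin n} (h : b ≠ a) (h' : b ≠ a.swap) :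
    (wt a - wt b) ⬝ᵥ (wt a - wt b) = 2 := by
  rcases a with i | i <;> rcases b with j | j <;> simp at h h' <;>
    simp [dotProduct_sub, Ne.symm, h, h']

/-- The weights μ + kα are pairwise distinct, and a finite-dimensional module has only finitely many
weights. -/
theorem exists_gen_pow_smul_eq_zero [Module.Finite ℂ V] {a b : Fin n ⊕ Fin n} (h : b ≠ a)
    (h' : b ≠ a.swap) {μ : Fin n → ℤ} {v : V} (hv : v ∈ wtSpace V μ) :
    ∃ k : ℕ, (gen a b : U n) ^ k • v = 0 := by
  have hmem : ∀ k : ℕ, (gen a b : U n) ^ k • v ∈ wtSpace V (μ + k • (wt a - wt b)) := by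
    intro k
    induction k with
    | zero => simpa using hv
    | succ k ih =>
      rw [pow_succ', mul_smul, succ_nsmul, ← add_assoc]
      exact gen_smul_mem ih a b
  by_contra! hne
  have hinj : Function.Injective fun k : ℕ => μ + k • (wt a - wt b) := by
    intro k l hkl
    have h1 : (μ + k • (wt a - wt b)) ⬝ᵥ (wt a - wt b) =
        (μ + l • (wt a - wt b)) ⬝ᵥ (wt a - wt b) := congrArg (· ⬝ᵥ (wt a - wt b)) hkl
    rw [add_dotProduct, add_dotProduct, smul_dotProduct, smul_dotProduct,
      root_dotProduct_self h h', nsmul_eq_mul, nsmul_eq_mul] at h1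
    omega
  have hind := (iSupIndep_wtSpace (n := n) V).comp hinj
  have hfin := WellFoundedGT.finite_ne_bot_of_iSupIndep hind
  refine Set.infinite_univ (α := ℕ) (hfin.subset fun k _ => ?_)
  exact (Submodule.ne_bot_iff _).2 ⟨_, hmem k, hne k⟩

/-- The difference `e f - f e` acts on a weight space by a scalar. -/
theorem gen_gen_smul {a b : Fin n ⊕ Fin n} (h' : b ≠ a.swap) {μ : Fin n → ℤ}
    {v : V} (hv : v ∈ wtSpace V μ) :
    (gen a b : U n) • (gen b a : U n) • v = (gen b a : U n) • (gen a b : U n) • v +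
      ((μ ⬝ᵥ (wt a - wt b) : ℤ) : ℂ) • v := by
  rw [← mul_smul, gen_mul_comm_of_ne h', add_smul, sub_smul, mul_smul, gen_self_smul hv,
    gen_self_smul hv, ← sub_smul, dotProduct_sub]
  push_cast
  rfl

/-- The 𝔰𝔩₂ relation for e f^{j+1}, with the term f e v kept because v need not be a highest weight
vector. -/
theorem gen_gen_pow_smul {a b : Fin n ⊕ Fin n} (h : b ≠ a) (h' : b ≠ a.swap) {μ : Fin n → ℤ}
    {v : V} (hv : v ∈ wtSpace V μ) (j : ℕ) :
    (gen a b : U n) • (gen b a : U n) ^ (j + 1) • v =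
      (gen b a : U n) ^ j • ((gen b a : U n) • (gen a b : U n) • v +
        (((j + 1) * (μ ⬝ᵥ (wt a - wt b) - j) : ℤ) : ℂ) • v) := by
  have hmem : ∀ k : ℕ, (gen b a : U n) ^ k • v ∈ wtSpace V (μ + k • (wt b - wt a)) := by
    intro k
    induction k with
    | zero => simpa using hv
    | succ k ih =>
      rw [pow_succ', mul_smul, succ_nsmul, ← add_assoc]
      exact gen_smul_mem ih b a
  induction j with
  | zero => simp [gen_gen_smul h' hv]
  | succ j ih =>
    have hdot : (μ + (j + 1) • (wt b - wt a)) ⬝ᵥ (wt a - wt b) =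
        μ ⬝ᵥ (wt a - wt b) - 2 * (j + 1) := by
      rw [← neg_sub (wt a) (wt b), add_dotProduct, smul_dotProduct, neg_dotProduct,
        root_dotProduct_self h h']
      simp; ring
    rw [pow_succ' _ (j + 1), mul_smul, gen_gen_smul h' (hmem (j + 1)), ih, hdot, ← mul_smul,
      ← pow_succ', smul_comm _ ((gen b a : U n) ^ (j + 1)) v, ← smul_add, add_assoc, ← add_smul]
    congr 4
    push_cast
    ring

/-- `f e + κ` is injective on weight spaces of nonnegative weight, for `κ > 0`. -/
theorem eq_zero_of_gen_gen_smul [Module.Finite ℂ V] {a b : Fin n ⊕ Fin n} (h : b ≠ a)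
    (h' : b ≠ a.swap) {μ : Fin n → ℤ} {v : V} (hv : v ∈ wtSpace V μ)
    (hμ : 0 ≤ μ ⬝ᵥ (wt a - wt b)) {κ : ℤ} (hκ : 0 < κ)
    (h0 : (gen b a : U n) • (gen a b : U n) • v + (κ : ℂ) • v = 0) : v = 0 := by
  obtain ⟨k, hk⟩ := exists_gen_pow_smul_eq_zero h h' hv
  induction k generalizing v μ κ with
  | zero => simpa using hk
  | succ k ih =>
    have hw := gen_smul_mem hv a b
    have hdot : (μ + (wt a - wt b)) ⬝ᵥ (wt a - wt b) = μ ⬝ᵥ (wt a - wt b) + 2 := by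
      rw [add_dotProduct, root_dotProduct_self h h']
    have hfe : (gen b a : U n) • (gen a b : U n) • v = -((κ : ℂ) • v) := eq_neg_of_add_eq_zero_left h0
    -- Applying e to f e v = -κ v shows that e v satisfies the same kind of equation with κ + (μ, α)
    -- + 2 in place of κ, and a smaller power of e kills it.
    have key : (gen a b : U n) • v = 0 := by
      refine ih hw (κ := κ + (μ ⬝ᵥ (wt a - wt b) + 2)) (by omega) (by omega) ?_ ?_
      · have h1 := gen_gen_smul h' hw
        rw [hfe, smul_neg, smul_comm, hdot] at h1
        rw [Int.cast_add, add_smul, add_left_comm, ← h1]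
        exact add_neg_cancel _
      · rwa [← mul_smul, ← pow_succ]
    rw [key, smul_zero, zero_add] at h0
    exact (smul_eq_zero.1 h0).resolve_left (by exact_mod_cast hκ.ne')

/-- Applying e to f^{j+1} v = 0 gives f^j (f e + κ) v = 0 with κ = (j+1)((μ, α) - j) > 0. Induction
removes f^j, and f e + κ is injective. -/
theorem eq_zero_of_gen_pow_smul [Module.Finite ℂ V] {a b : Fin n ⊕ Fin n} (h : b ≠ a)
    (h' : b ≠ a.swap) {μ : Fin n → ℤ} {v : V} (hv : v ∈ wtSpace V μ) {j : ℕ}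
    (hj : (j : ℤ) ≤ μ ⬝ᵥ (wt a - wt b)) (h0 : (gen b a : U n) ^ j • v = 0) : v = 0 := by
  induction j generalizing v with
  | zero => simpa using h0
  | succ j ih =>
    push_cast at hj
    have h1 := gen_gen_pow_smul h h' hv j
    rw [h0, smul_zero] at h1
    have hmem : (gen b a : U n) • (gen a b : U n) • v +
        (((j + 1) * (μ ⬝ᵥ (wt a - wt b) - j) : ℤ) : ℂ) • v ∈ wtSpace V μ := by
      refine add_mem ?_ (Submodule.smul_mem _ _ hv)
      have := gen_smul_mem (gen_smul_mem hv a b) b a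
      rwa [show μ + (wt a - wt b) + (wt b - wt a) = μ by abel] at this
    refine eq_zero_of_gen_gen_smul h h' hv (by omega) ?_ (ih hmem (by omega) h1.symm)
    exact mul_pos (by omega) (by omega)

/-- The power f^c with c = (μ, α) maps the weight space of μ injectively into that of the reflected
weight; complete reducibility is not needed. -/
theorem finrank_wtSpace_le_refl [Module.Finite ℂ V] {a b : Fin n ⊕ Fin n} (h : b ≠ a)
    (h' : b ≠ a.swap) {μ : Fin n → ℤ} (hμ : 0 ≤ μ ⬝ᵥ (wt a - wt b)) :
    Module.finrank ℂ (wtSpace V μ) ≤ Module.finrank ℂ (wtSpace V (refl a b μ)) := by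
  obtain ⟨c, hc⟩ := Int.eq_ofNat_of_zero_le hμ
  have hmem : ∀ k : ℕ, ∀ v ∈ wtSpace V μ,
      (gen b a : U n) ^ k • v ∈ wtSpace V (μ - k • (wt a - wt b)) := by
    intro k v hv
    induction k with
    | zero => simpa using hv
    | succ k ih =>
      rw [pow_succ', mul_smul, succ_nsmul, sub_add_eq_sub_sub, sub_eq_add_neg _ (wt a - wt b),
        neg_sub]
      exact gen_smul_mem ih b a
  let f : wtSpace V μ →ₗ[ℂ] wtSpace V (refl a b μ) :=
    ((Algebra.lsmul ℂ ℂ V ((gen b a : U n) ^ c)).comp (wtSpace V μ).subtype).codRestrict _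
      fun v => by
        have := hmem c v v.2
        rw [refl, hc, natCast_zsmul]
        exact this
  refine LinearMap.finrank_le_finrank_of_injective (f := f) ?_
  rw [← LinearMap.ker_eq_bot, LinearMap.ker_eq_bot']
  intro v hv
  apply Subtype.ext
  refine eq_zero_of_gen_pow_smul h h' v.2 (j := c) hc.ge ?_
  exact congrArg Subtype.val hv

theorem refl_refl {a b : Fin n ⊕ Fin n} (h : b ≠ a) (h' : b ≠ a.swap) (μ : Fin n → ℤ) :
    refl a b (refl a b μ) = μ := by
  simp only [refl, sub_dotProduct, smul_dotProduct,
    root_dotProduct_self h h', smul_eq_mul]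
  module

theorem finrank_wtSpace_refl [Module.Finite ℂ V] {a b : Fin n ⊕ Fin n} (h : b ≠ a)
    (h' : b ≠ a.swap) (μ : Fin n → ℤ) :
    Module.finrank ℂ (wtSpace V (refl a b μ)) = Module.finrank ℂ (wtSpace V μ) := by
  have hle : ∀ (a b : Fin n ⊕ Fin n), b ≠ a → b ≠ a.swap → ∀ μ : Fin n → ℤ,
      0 ≤ μ ⬝ᵥ (wt a - wt b) →
      Module.finrank ℂ (wtSpace V (refl a b μ)) = Module.finrank ℂ (wtSpace V μ) := by
    intro a b h h' μ hμ
    refine le_antisymm ?_ (finrank_wtSpace_le_refl h h' hμ)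
    have hflip : ∀ ν, refl b a ν = refl a b ν := by
      intro ν
      rw [refl, refl, ← neg_sub (wt a) (wt b), dotProduct_neg]
      module
    have h2 : a ≠ b.swap := fun h2 => h' (by simp [h2])
    have := finrank_wtSpace_le_refl (V := V) h.symm h2 (μ := refl a b μ) (by
      rw [refl, sub_dotProduct, smul_dotProduct, ← neg_sub (wt a) (wt b), dotProduct_neg,
        dotProduct_neg, root_dotProduct_self h h', smul_eq_mul]
      omega)
    rwa [hflip, refl_refl h h'] at this
  rcases le_total 0 (μ ⬝ᵥ (wt a - wt b)) with hμ | hμ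
  · exact hle a b h h' μ hμ
  · have := hle a b h h' (refl a b μ) (by
      rw [refl, sub_dotProduct, smul_dotProduct, root_dotProduct_self h h', smul_eq_mul]
      omega)
    rw [refl_refl h h'] at this
    exact this.symm

end Reflections

end TypeD

end

/-! ### Finite-dimensional modules realising highest weights -/

noncomputable section

namespace TypeD

attribute [local instance 100] LieRing.ofAssociativeRing

/-! ### Finite-dimensional modules with a given highest weight -/

/-- There is a finite-dimensional `𝔰𝔬_{2n}`-module with a nonzero highest weight vector of weight
`lam`. -/
def HasHighest {n : ℕ} (lam : Fin n → ℤ) : Prop :=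
  ∃ (M : Type) (_ : AddCommGroup M) (_ : Module ℂ M) (_ : Module.Finite ℂ M)
    (φ : so n →ₗ⁅ℂ⁆ Module.End ℂ M) (v : M), v ≠ 0 ∧
    (∀ i, φ (elt (.inl i) (.inl i)) v = (lam i : ℂ) • v) ∧
    ∀ a b : Fin n ⊕ Fin n, rho ⬝ᵥ wt b < rho ⬝ᵥ wt a → φ (elt a b) v = 0

theorem tmul_ne_zero {M N : Type*} [AddCommGroup M] [Module ℂ M] [AddCommGroup N] [Module ℂ N]
    {v : M} {w : N} (hv : v ≠ 0) (hw : w ≠ 0) : (v ⊗ₜ[ℂ] w : TensorProduct ℂ M N) ≠ 0 := by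
  intro h
  obtain ⟨f, hf⟩ := not_forall.1 (mt (Module.forall_dual_apply_eq_zero_iff ℂ v).1 hv)
  obtain ⟨g, hg⟩ := not_forall.1 (mt (Module.forall_dual_apply_eq_zero_iff ℂ w).1 hw)
  have := congrArg (LinearMap.mul' ℂ ℂ ∘ₗ TensorProduct.map f g) h
  simp only [LinearMap.comp_apply, TensorProduct.map_tmul, LinearMap.mul'_apply, map_zero] at this
  exact mul_ne_zero hf hg this

theorem HasHighest.add {n : ℕ} {lam μ : Fin n → ℤ} (h₁ : HasHighest lam) (h₂ : HasHighest μ) :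
    HasHighest (lam + μ) := by
  obtain ⟨M, _, _, _, φ, v, hv, hc, hr⟩ := h₁
  obtain ⟨N, _, _, _, ψ, w, hw, hc', hr'⟩ := h₂
  refine ⟨TensorProduct ℂ M N, inferInstance, inferInstance, inferInstance,
    { toFun := fun x => (φ x).rTensor N + (ψ x).lTensor M
      map_add' := fun x y => by
        rw [map_add, map_add, LinearMap.rTensor_add, LinearMap.lTensor_add]; abel
      map_smul' := fun c x => by
        rw [map_smul, map_smul, LinearMap.rTensor_smul, LinearMap.lTensor_smul, smul_add]; rfl
      map_lie' := fun {x y} => by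
        refine TensorProduct.ext' fun m m' => ?_
        simp only [LieHom.map_lie, LieRing.of_associative_ring_bracket, LinearMap.add_apply,
          LinearMap.sub_apply, Module.End.mul_apply, LinearMap.rTensor_tmul,
          LinearMap.lTensor_tmul, map_add, TensorProduct.sub_tmul, TensorProduct.tmul_sub]
        abel }, v ⊗ₜ w, tmul_ne_zero hv hw, fun i => ?_, fun a b hab => ?_⟩
  · change (φ _).rTensor N _ + (ψ _).lTensor M _ = _
    rw [LinearMap.rTensor_tmul, LinearMap.lTensor_tmul, hc, hc', ← TensorProduct.smul_tmul',
      TensorProduct.tmul_smul, ← add_smul]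
    simp
  · change (φ _).rTensor N _ + (ψ _).lTensor M _ = _
    rw [LinearMap.rTensor_tmul, LinearMap.lTensor_tmul, hr a b hab, hr' a b hab,
      TensorProduct.zero_tmul, TensorProduct.tmul_zero, add_zero]

/-! ### The action on the exterior algebra -/

/-- The determinant in the coordinates c is an alternating form with value 1 on these vectors. -/
theorem ιMulti_single_ne_zero {ι : Type*} [DecidableEq ι] {m : ℕ} {c : Fin m → ι} (hc : Function.Injective c) :
    ExteriorAlgebra.ιMulti ℂ m (fun p => (Pi.single (c p) 1 : ι → ℂ)) ≠ 0 := by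
  intro h
  let f : (ι → ℂ) [⋀^Fin m]→ₗ[ℂ] ℂ :=
    Matrix.detRowAlternating.compLinearMap (LinearMap.funLeft ℂ ℂ c)
  let F : ∀ i, (ι → ℂ) [⋀^Fin i]→ₗ[ℂ] ℂ := Function.update 0 m f
  have h1 := ExteriorAlgebra.liftAlternating_apply_ιMulti F
    (fun p => (Pi.single (c p) 1 : ι → ℂ))
  rw [h, map_zero, show F m = f from Function.update_self _ _ _] at h1
  have h2 : f (fun p => (Pi.single (c p) 1 : ι → ℂ)) = Matrix.det (1 : Matrix (Fin m) (Fin m) ℂ) := by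
    rw [AlternatingMap.compLinearMap_apply]
    change Matrix.det _ = _
    congr 1
    ext p q
    simp [LinearMap.funLeft_apply, Matrix.one_apply, Pi.single_apply, hc.eq_iff, eq_comm]
  rw [h2, Matrix.det_one] at h1
  exact zero_ne_one h1

section Exterior

variable {ι : Type*} [Fintype ι] [DecidableEq ι]

open CliffordAlgebra in
/-- The operator on the exterior algebra of `ℂ^ι` induced by a matrix. -/
def extAction : Matrix ι ι ℂ →ₗ[ℂ] Module.End ℂ (ExteriorAlgebra ℂ (ι → ℂ)) where
  toFun A := ∑ b, (LinearMap.mulLeft ℂ (ExteriorAlgebra.ι ℂ (A.mulVec (Pi.single b 1)))).comp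
    (contractLeft (Q := (0 : QuadraticForm ℂ (ι → ℂ))) (LinearMap.proj b))
  map_add' A B := by
    rw [← Finset.sum_add_distrib]
    refine Finset.sum_congr rfl fun b _ => ?_
    rw [Matrix.add_mulVec, map_add]
    refine LinearMap.ext fun x => ?_
    simp only [LinearMap.comp_apply, LinearMap.add_apply, LinearMap.mulLeft_apply, add_mul]
  map_smul' c A := by
    rw [RingHom.id_apply, Finset.smul_sum]
    refine Finset.sum_congr rfl fun b _ => ?_
    rw [Matrix.smul_mulVec, map_smul]
    refine LinearMap.ext fun x => ?_
    simp only [LinearMap.comp_apply, LinearMap.smul_apply, LinearMap.mulLeft_apply, smul_mul_assoc]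

theorem extAction_apply (A : Matrix ι ι ℂ) (x : ExteriorAlgebra ℂ (ι → ℂ)) :
    extAction A x = ∑ b, ExteriorAlgebra.ι ℂ (A.mulVec (Pi.single b 1)) *
      CliffordAlgebra.contractLeft (Q := (0 : QuadraticForm ℂ (ι → ℂ))) (LinearMap.proj b) x := by
  simp [extAction, LinearMap.sum_apply]

theorem extAction_algebraMap (A : Matrix ι ι ℂ) (c : ℂ) :
    extAction A (algebraMap ℂ _ c) = 0 := by
  rw [extAction_apply]
  refine Finset.sum_eq_zero fun b _ => ?_
  have := CliffordAlgebra.contractLeft_algebraMap (Q := (0 : QuadraticForm ℂ (ι → ℂ)))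
    (LinearMap.proj b) c
  exact (congrArg _ this).trans (mul_zero _)

/-- The sign from contracting past w cancels the sign from anticommuting w with A e_b, so the
operator obeys the Leibniz rule without signs. -/
theorem extAction_ι_mul (A : Matrix ι ι ℂ) (w : ι → ℂ) (x : ExteriorAlgebra ℂ (ι → ℂ)) :
    extAction A (ExteriorAlgebra.ι ℂ w * x) =
      ExteriorAlgebra.ι ℂ (A.mulVec w) * x + ExteriorAlgebra.ι ℂ w * extAction A x := by
  have hw : A.mulVec w = ∑ b, w b • A.mulVec (Pi.single b 1) := by
    ext i
    simp [Matrix.mulVec, dotProduct, mul_comm]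
  rw [extAction_apply, extAction_apply, hw, map_sum, Finset.sum_mul, Finset.mul_sum,
    ← Finset.sum_add_distrib]
  refine Finset.sum_congr rfl fun b _ => ?_
  have := CliffordAlgebra.contractLeft_ι_mul (Q := (0 : QuadraticForm ℂ (ι → ℂ)))
    (d := LinearMap.proj b) w x
  refine (congrArg _ this).trans ?_
  have hanti : ExteriorAlgebra.ι ℂ (A.mulVec (Pi.single b 1)) * ExteriorAlgebra.ι ℂ w =
      -(ExteriorAlgebra.ι ℂ w * ExteriorAlgebra.ι ℂ (A.mulVec (Pi.single b 1))) :=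
    eq_neg_of_add_eq_zero_left (ExteriorAlgebra.ι_add_mul_swap _ _)
  rw [mul_sub, mul_smul_comm, LinearMap.proj_apply, map_smul, smul_mul_assoc, ← mul_assoc,
    ← mul_assoc, sub_eq_add_neg]
  congr 1
  rw [← neg_mul]
  congr 1
  exact neg_eq_iff_eq_neg.2 hanti

theorem extAction_lie (A B : Matrix ι ι ℂ) :
    extAction (A * B - B * A) = extAction A * extAction B - extAction B * extAction A := by
  refine LinearMap.ext fun x => ?_
  induction x using CliffordAlgebra.left_induction with
  | algebraMap c =>
    have h := fun A => extAction_algebraMap (ι := ι) A c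
    rw [LinearMap.sub_apply, Module.End.mul_apply, Module.End.mul_apply]
    erw [h, h, h]
    simp
  | add x y hx hy => rw [map_add, hx, hy, map_add]
  | ι_mul x w hx =>
    have h := fun A x => extAction_ι_mul (ι := ι) A w x
    rw [LinearMap.sub_apply, Module.End.mul_apply, Module.End.mul_apply] at hx ⊢
    erw [h, h, h, map_add, map_add, h, h, hx]
    rw [extAction_ι_mul, extAction_ι_mul, Matrix.sub_mulVec, ← Matrix.mulVec_mulVec,
      ← Matrix.mulVec_mulVec, map_sub, sub_mul, mul_sub]
    abel

theorem extAction_ιMulti (A : Matrix ι ι ℂ) {m : ℕ} (v : Fin m → ι → ℂ) :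
    extAction A (ExteriorAlgebra.ιMulti ℂ m v) =
      ∑ p, ExteriorAlgebra.ιMulti ℂ m (Function.update v p (A.mulVec (v p))) := by
  induction m with
  | zero =>
    rw [ExteriorAlgebra.ιMulti_zero_apply]
    simpa using extAction_algebraMap A 1
  | succ m ih =>
    rw [ExteriorAlgebra.ιMulti_succ_apply, extAction_ι_mul, Fin.sum_univ_succ]
    congr 1
    · rw [ExteriorAlgebra.ιMulti_succ_apply]
      congr 2
    · rw [show Matrix.vecTail v = fun i => v i.succ from rfl, ih, Finset.mul_sum]
      refine Finset.sum_congr rfl fun p _ => ?_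
      rw [ExteriorAlgebra.ιMulti_succ_apply]
      congr 2
      funext q
      by_cases hq : q = p
      · subst hq; simp [Matrix.vecTail]
      · simp [Matrix.vecTail, hq]

end Exterior

/-- The vector is the wedge of the basis vectors indexed by c. By `hup` this index set is closed
upwards, so a raising operator replaces a factor by one that is already present. -/
theorem hasHighest_of_injective {n m : ℕ} {c : Fin m → Fin n ⊕ Fin n}
    (hc : Function.Injective c)
    (hup : ∀ p a, rho ⬝ᵥ wt (c p) < rho ⬝ᵥ wt a → ∃ p', c p' = a) :
    HasHighest (∑ p, wt (c p) : Fin n → ℤ) := by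
  let φ : so n →ₗ⁅ℂ⁆ Module.End ℂ (ExteriorAlgebra ℂ (Fin n ⊕ Fin n → ℂ)) :=
    { toFun := fun x => extAction (x : Matrix _ _ ℂ)
      map_add' := fun x y => map_add _ _ _
      map_smul' := fun c x => map_smul _ _ _
      map_lie' := fun {x y} => by
        rw [LieSubalgebra.coe_bracket, Ring.lie_def, extAction_lie]; rfl }
  have hfin : Module.Finite ℂ (ExteriorAlgebra ℂ (Fin n ⊕ Fin n → ℂ)) :=
    Module.Finite.of_basis
      ((Pi.basisFun ℂ (Fin n ⊕ Fin n)).reindex finSumFinEquiv).ExteriorAlgebra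
  have hcol : ∀ a b d : Fin n ⊕ Fin n,
      (elt a b : Matrix _ _ ℂ).mulVec (Pi.single d 1) =
        (if b = d then (1 : ℂ) else 0) • (Pi.single a 1 : Fin n ⊕ Fin n → ℂ) -
          (if a.swap = d then (1 : ℂ) else 0) • Pi.single b.swap 1 := by
    intro a b d
    ext e
    by_cases h1 : b = d <;> by_cases h2 : a.swap = d <;>
      simp [elt, Matrix.single_apply, Pi.single_apply, h1, h2, eq_comm]
  refine ⟨ExteriorAlgebra ℂ (Fin n ⊕ Fin n → ℂ), inferInstance, inferInstance, hfin, φ,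
    ExteriorAlgebra.ιMulti ℂ m fun p => Pi.single (c p) 1, ιMulti_single_ne_zero hc,
    fun i => ?_, fun a b hab => ?_⟩
  · change extAction _ _ = _
    have hdiag : ∀ d : Fin n ⊕ Fin n,
        (elt (.inl i) (.inl i) : Matrix _ _ ℂ).mulVec (Pi.single d 1) =
          ((wt d i : ℤ) : ℂ) • Pi.single d 1 := by
      intro d
      rw [hcol]
      rcases d with j | j <;> by_cases h : i = j <;> simp [h]
    rw [extAction_ιMulti]
    simp only [hdiag, AlternatingMap.map_update_smul, Function.update_eq_self]
    rw [← Finset.sum_smul]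
    simp
  · change extAction _ _ = _
    rw [extAction_ιMulti]
    refine Finset.sum_eq_zero fun p _ => ?_
    have hz : ∀ a : Fin n ⊕ Fin n, rho ⬝ᵥ wt (c p) < rho ⬝ᵥ wt a →
        ExteriorAlgebra.ιMulti ℂ m (Function.update (fun p => (Pi.single (c p) 1 : _ → ℂ)) p
          (Pi.single a 1)) = 0 := by
      intro a ha
      obtain ⟨p', rfl⟩ := hup p a ha
      have hne : p' ≠ p := by rintro rfl; exact lt_irrefl _ ha
      refine AlternatingMap.map_eq_zero_of_eq _ _ (i := p) (j := p') ?_ hne.symm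
      simp [hne]
    rw [hcol, AlternatingMap.map_update_sub, AlternatingMap.map_update_smul,
      AlternatingMap.map_update_smul]
    have h1 : (if b = c p then (1 : ℂ) else 0) • ExteriorAlgebra.ιMulti ℂ m (Function.update
        (fun p => (Pi.single (c p) 1 : _ → ℂ)) p (Pi.single a 1)) = 0 := by
      split_ifs with h
      · rw [hz a (h ▸ hab), smul_zero]
      · rw [zero_smul]
    have h2 : (if a.swap = c p then (1 : ℂ) else 0) • ExteriorAlgebra.ιMulti ℂ m (Function.update
        (fun p => (Pi.single (c p) 1 : _ → ℂ)) p (Pi.single b.swap 1)) = 0 := by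
      split_ifs with h
      · rw [hz b.swap, smul_zero]
        rw [← h, wt_swap, wt_swap, dotProduct_neg, dotProduct_neg]
        omega
      · rw [zero_smul]
    rw [h1, h2, sub_zero]

/-- The annihilator N of v is a proper left ideal containing `vermaIdeal`, so N ≤ `maxIdeal`. Hence
the simple module is a quotient of the cyclic submodule generated by v. -/
theorem HasHighest.vermaIdeal_ne_top_and_finite {n : ℕ} {lam : Fin n → ℤ} (h : HasHighest lam) :
    vermaIdeal lam ≠ ⊤ ∧ Module.Finite ℂ (L lam) := by
  obtain ⟨M, _, _, _, φ, v, hv, hc, hr⟩ := h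
  let F : U n →ₐ[ℂ] Module.End ℂ M := UniversalEnvelopingAlgebra.lift ℂ φ
  have hF : ∀ x, F (toU x) = φ x := UniversalEnvelopingAlgebra.lift_ι_apply ℂ φ
  let N : Submodule (U n) (U n) :=
    { carrier := {u | F u v = 0}
      zero_mem' := by simp
      add_mem' := fun {x y} hx hy => by
        change F x v = 0 at hx
        change F y v = 0 at hy
        change F (x + y) v = 0
        rw [map_add, LinearMap.add_apply, hx, hy, add_zero]
      smul_mem' := fun u x hx => by
        change F x v = 0 at hx
        change F (u • x) v = 0
        rw [smul_eq_mul, map_mul, Module.End.mul_apply, hx, map_zero] }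
  have hle : vermaIdeal lam ≤ N := by
    refine Submodule.span_le.2 ?_
    rintro u (⟨i, j, hij, rfl | rfl⟩ | ⟨i, rfl⟩)
    · change F _ v = 0
      rw [hF, rootVecSub_eq]
      exact hr _ _ (by simpa [rho] using hij)
    · change F _ v = 0
      rw [hF, rootVecAdd_eq]
      refine hr _ _ ?_
      have hlt : (i : ℕ) < j := hij
      have hi := i.2
      have hj := j.2
      simp [rho]
      omega
    · change F _ v = 0
      rw [map_sub, LinearMap.sub_apply, hF, cartan_eq, hc, AlgHom.commutes,
        Module.algebraMap_end_apply, sub_self]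
  have hN : N ≠ ⊤ := by
    intro htop
    have : (1 : U n) ∈ N := by rw [htop]; trivial
    refine hv ?_
    have h1 : F 1 v = 0 := this
    simpa using h1
  refine ⟨fun htop => hN (top_le_iff.1 (htop ▸ hle)), ?_⟩
  have hmax : N ≤ maxIdeal lam := le_sSup ⟨hle, hN⟩
  let f : U n →ₗ[ℂ] M := (LinearMap.applyₗ v).comp F.toLinearMap
  let g : (U n ⧸ LinearMap.ker f) →ₗ[ℂ] L lam :=
    (LinearMap.ker f).liftQ ((maxIdeal lam).mkQ.restrictScalars ℂ) (by
      intro u hu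
      rw [LinearMap.mem_ker] at hu ⊢
      exact (Submodule.Quotient.mk_eq_zero _).2 (hmax hu))
  have : Module.Finite ℂ (U n ⧸ LinearMap.ker f) :=
    Module.Finite.equiv f.quotKerEquivRange.symm
  refine Module.Finite.of_surjective g fun w => ?_
  obtain ⟨u, rfl⟩ := (maxIdeal lam).mkQ_surjective w
  exact ⟨(LinearMap.ker f).mkQ u, rfl⟩

end TypeD

end

/-! ### From the Casimir element to the Weyl character formula -/

noncomputable section

namespace TypeD

/-! ### The Casimir element -/

/-- Twice the Casimir element. -/
def casimir (n : ℕ) : U n := ∑ a, ∑ b, gen a b * gen b a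

/-- The commutator with one product has eight terms; summed over all indices they cancel in pairs.
-/
theorem gen_mul_casimir {n : ℕ} (c d : Fin n ⊕ Fin n) :
    gen c d * casimir n = casimir n * gen c d := by
  have key : ∀ a b : Fin n ⊕ Fin n, gen c d * (gen a b * gen b a) =
      gen a b * gen b a * gen c d +
        (((if d = a then gen c b * gen b d else 0) - (if b = c then gen a d * gen c a else 0) -
          (if c.swap = a then gen d.swap b * gen b c.swap else 0) +
            if b = d.swap then gen a c.swap * gen d.swap a else 0) +
        ((if d = b then gen a d * gen c a else 0) - (if a = c then gen c b * gen b d else 0) -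
          (if c.swap = b then gen a c.swap * gen d.swap a else 0) +
            if a = d.swap then gen d.swap b * gen b c.swap else 0)) := by
    intro a b
    rw [← mul_assoc, gen_mul_gen c d a b, add_mul, mul_assoc, gen_mul_gen c d b a, mul_add,
      ← mul_assoc]
    simp only [add_mul, sub_mul, mul_add, mul_sub, ite_mul, mul_ite, zero_mul, mul_zero]
    have h1 : (if d = a then gen c b * gen b a else 0) =
        if d = a then gen c b * gen b d else 0 := by split_ifs with h <;> simp [h]
    have h2 : (if b = c then gen a d * gen b a else 0) =
        if b = c then gen a d * gen c a else 0 := by split_ifs with h <;> simp [h]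
    have h3 : (if c.swap = a then gen d.swap b * gen b a else 0) =
        if c.swap = a then gen d.swap b * gen b c.swap else 0 := by split_ifs with h <;> simp [h]
    have h4 : (if b = d.swap then gen a c.swap * gen b a else 0) =
        if b = d.swap then gen a c.swap * gen d.swap a else 0 := by split_ifs with h <;> simp [h]
    have h5 : (if d = b then gen a b * gen c a else 0) =
        if d = b then gen a d * gen c a else 0 := by split_ifs with h <;> simp [h]
    have h6 : (if a = c then gen a b * gen b d else 0) =
        if a = c then gen c b * gen b d else 0 := by split_ifs with h <;> simp [h]
    have h7 : (if c.swap = b then gen a b * gen d.swap a else 0) =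
        if c.swap = b then gen a c.swap * gen d.swap a else 0 := by split_ifs with h <;> simp [h]
    have h8 : (if a = d.swap then gen a b * gen b c.swap else 0) =
        if a = d.swap then gen d.swap b * gen b c.swap else 0 := by split_ifs with h <;> simp [h]
    rw [h1, h2, h3, h4, h5, h6, h7, h8]
    abel
  have hout : ∀ (x : Fin n ⊕ Fin n) (f : Fin n ⊕ Fin n → U n),
      ∑ a, ∑ b, (if x = a then f b else 0) = ∑ b, f b := by
    intro x f
    rw [Finset.sum_comm]
    simp
  have hout' : ∀ (x : Fin n ⊕ Fin n) (f : Fin n ⊕ Fin n → U n),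
      ∑ a, ∑ b, (if a = x then f b else 0) = ∑ b, f b := by
    intro x f
    rw [Finset.sum_comm]
    simp
  have hin : ∀ (x : Fin n ⊕ Fin n) (f : Fin n ⊕ Fin n → U n),
      ∑ a, ∑ b, (if x = b then f a else 0) = ∑ b, f b := by
    intro x f
    simp
  have hin' : ∀ (x : Fin n ⊕ Fin n) (f : Fin n ⊕ Fin n → U n),
      ∑ a, ∑ b, (if b = x then f a else 0) = ∑ b, f b := by
    intro x f
    simp
  simp only [casimir, Finset.mul_sum, Finset.sum_mul, key, Finset.sum_add_distrib,
    Finset.sum_sub_distrib, hout, hout', hin, hin']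
  abel

theorem mul_casimir {n : ℕ} (u : U n) : u * casimir n = casimir n * u := by
  have := subalgebra_eq_top (Subalgebra.centralizer ℂ {casimir n})
    (fun a b => by
      rw [Subalgebra.mem_centralizer_iff]
      rintro _ rfl
      exact (gen_mul_casimir a b).symm) u
  rw [Subalgebra.mem_centralizer_iff] at this
  exact (this _ rfl).symm

/-! ### Characters and traces -/

/-- The additive map `ν ↦ (ν, w)`. -/
def dotHom {n : ℕ} (w : Fin n → ℤ) : (Fin n → ℤ) →+ ℤ where
  toFun ν := ν ⬝ᵥ w
  map_zero' := zero_dotProduct w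
  map_add' μ ν := add_dotProduct μ ν w

/-- The derivation `e^ν ↦ (ν, wt a) e^ν`. -/
def wtDeriv {n : ℕ} (a : Fin n ⊕ Fin n) : Derivation ℂ (CExp n) (CExp n) := deriv (dotHom (wt a))

theorem coeff_wtDeriv {n : ℕ} (a : Fin n ⊕ Fin n) (f : CExp n) (ν : Fin n → ℤ) :
    (wtDeriv a f).coeff ν = ((ν ⬝ᵥ wt a : ℤ) : ℂ) * f.coeff ν := coeff_deriv _ _ _

section Projections

variable {n : ℕ} {V : Type*} [AddCommGroup V] [Module ℂ V] [Module (U n) V]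
  [IsScalarTower ℂ (U n) V]

theorem exists_projections (htop : ⨆ μ, wtSpace V (μ : Fin n → ℤ) = ⊤) :
    ∃ p : (Fin n → ℤ) → Module.End ℂ V, (∀ μ, ∀ v ∈ wtSpace V μ, p μ v = v) ∧
      ∀ μ ν, ν ≠ μ → ∀ v ∈ wtSpace V ν, p μ v = 0 := by
  classical
  have hint : DirectSum.IsInternal (wtSpace V : (Fin n → ℤ) → Submodule ℂ V) :=
    DirectSum.isInternal_submodule_of_iSupIndep_of_iSup_eq_top (iSupIndep_wtSpace V) htop
  let _ := hint.chooseDecomposition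
  refine ⟨fun μ => (wtSpace V μ).subtype ∘ₗ DirectSum.component ℂ _ _ μ ∘ₗ
    (DirectSum.decomposeLinearEquiv (wtSpace V : (Fin n → ℤ) → Submodule ℂ V)).toLinearMap,
    fun μ v hv => ?_, fun μ ν hμν v hv => ?_⟩
  · exact DirectSum.decompose_of_mem_same _ hv
  · exact DirectSum.decompose_of_mem_ne _ hv hμν

theorem end_ext_of_wtSpace (htop : ⨆ μ, wtSpace V (μ : Fin n → ℤ) = ⊤) {f g : Module.End ℂ V}
    (h : ∀ μ : Fin n → ℤ, ∀ v ∈ wtSpace V μ, f v = g v) : f = g := by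
  refine LinearMap.ext fun v => ?_
  have hv : v ∈ ⨆ μ, wtSpace V (μ : Fin n → ℤ) := by rw [htop]; trivial
  induction hv using Submodule.iSup_induction' with
  | mem μ v hv => exact h μ v hv
  | zero => simp
  | add x y _ _ hx hy => rw [map_add, map_add, hx, hy]

end Projections

section Characters

variable {n : ℕ} (V : Type*) [AddCommGroup V] [Module ℂ V] [Module (U n) V]
  [IsScalarTower ℂ (U n) V] [Module.Finite ℂ V]

theorem finite_wtSpace_ne_bot : {μ : Fin n → ℤ | wtSpace V μ ≠ ⊥}.Finite :=
  WellFoundedGT.finite_ne_bot_of_iSupIndep (iSupIndep_wtSpace V)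

/-- The character of a finite-dimensional module. -/
def character : CExp n :=
  .ofCoeff (Finsupp.onFinset (finite_wtSpace_ne_bot (n := n) V).toFinset
    (fun μ => (Module.finrank ℂ (wtSpace V μ) : ℂ)) fun μ h => by
      rw [Set.Finite.mem_toFinset]
      intro h0
      rw [h0, finrank_bot] at h
      simp at h)

theorem coeff_character (μ : Fin n → ℤ) :
    (character V).coeff μ = Module.finrank ℂ (wtSpace V μ) := rfl

variable {V}

/-- T a b collects the traces of E_{ab} E_{ba} on all weight spaces. The first relation is cyclicity
of the trace, the second the commutator of the two root vectors, the last the scalar action of the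
Casimir element. -/
theorem exists_traces (htop : ⨆ μ, wtSpace V (μ : Fin n → ℤ) = ⊤) {c : ℂ}
    (hc : ∀ v : V, casimir n • v = c • v) :
    ∃ T : Fin n ⊕ Fin n → Fin n ⊕ Fin n → CExp n,
      (∀ a b, T a b = mono (wt a - wt b) * T b a) ∧
      (∀ a b, b ≠ a.swap → T a b - T b a =
        wtDeriv a (character V) - wtDeriv b (character V)) ∧
      (∀ a, T a a = wtDeriv a (wtDeriv a (character V))) ∧ (∀ a, T a a.swap = 0) ∧
      ∑ a, ∑ b, T a b = c • character V := by
  obtain ⟨p, hp, hp'⟩ := exists_projections htop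
  let ρ : U n →ₐ[ℂ] Module.End ℂ V := Algebra.lsmul ℂ ℂ V
  have hρ : ∀ u v, ρ u v = u • v := fun _ _ => rfl
  have hproj : ∀ μ, LinearMap.IsProj (wtSpace V μ) (p μ) := by
    intro μ
    refine ⟨fun v => ?_, hp μ⟩
    have hv : v ∈ ⨆ μ, wtSpace V (μ : Fin n → ℤ) := by rw [htop]; trivial
    induction hv using Submodule.iSup_induction' with
    | mem ν v hv =>
      by_cases h : ν = μ
      · subst h; rwa [hp _ _ hv]
      · rw [hp' _ _ h _ hv]; exact zero_mem _
    | zero => simp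
    | add x y _ _ hx hy => rw [map_add]; exact add_mem hx hy
  have htr : ∀ μ, LinearMap.trace ℂ V (p μ) = Module.finrank ℂ (wtSpace V μ) :=
    fun μ => (hproj μ).trace
  have hcomm : ∀ μ a b, p μ * ρ (gen a b) = ρ (gen a b) * p (μ - (wt a - wt b)) := by
    intro μ a b
    refine end_ext_of_wtSpace htop fun ν v hv => ?_
    rw [Module.End.mul_apply, Module.End.mul_apply, hρ]
    have hm := gen_smul_mem hv a b
    by_cases h : ν = μ - (wt a - wt b)
    · have h2 : ν + (wt a - wt b) = μ := by rw [h]; abel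
      rw [h2] at hm
      rw [hp _ _ hm, ← h, hp _ _ hv, hρ]
    · rw [hp' _ _ h _ hv, map_zero, hp' μ _ _ _ hm]
      rintro rfl
      exact h (by abel)
  have hdiag : ∀ μ a, ρ (gen a a) * p μ = ((μ ⬝ᵥ wt a : ℤ) : ℂ) • p μ := by
    intro μ a
    refine LinearMap.ext fun v => ?_
    rw [Module.End.mul_apply, hρ, gen_self_smul ((hproj μ).map_mem v), LinearMap.smul_apply]
  have hcas : ∀ μ, ρ (casimir n) * p μ = c • p μ := by
    intro μ
    refine LinearMap.ext fun v => ?_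
    rw [Module.End.mul_apply, hρ, hc, LinearMap.smul_apply]
  have hbot : ∀ μ, wtSpace V μ = ⊥ → p μ = 0 := by
    intro μ h
    refine LinearMap.ext fun v => ?_
    have := (hproj μ).map_mem v
    rw [h] at this
    simpa using this
  let t : Fin n ⊕ Fin n → Fin n ⊕ Fin n → (Fin n → ℤ) → ℂ := fun a b μ =>
    LinearMap.trace ℂ V (ρ (gen a b * gen b a) * p μ)
  let T : Fin n ⊕ Fin n → Fin n ⊕ Fin n → CExp n := fun a b =>
    .ofCoeff (Finsupp.onFinset (finite_wtSpace_ne_bot (n := n) V).toFinset (t a b) fun μ h => by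
      rw [Set.Finite.mem_toFinset]
      intro h0
      exact h (by simp only [t]; rw [hbot μ h0, mul_zero, map_zero]))
  have hT : ∀ a b μ, (T a b).coeff μ = t a b μ := fun _ _ _ => rfl
  refine ⟨T, fun a b => ?_, fun a b hab => ?_, fun a => ?_, fun a => ?_, ?_⟩
  · ext μ
    rw [coeff_mono_mul, hT, hT]
    simp only [t]
    rw [map_mul ρ, mul_assoc, LinearMap.trace_mul_comm, mul_assoc, hcomm, ← mul_assoc, ← map_mul ρ]
  · ext μ
    simp only [AddMonoidAlgebra.coeff_sub, Finsupp.sub_apply, coeff_wtDeriv, hT, t,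
      coeff_character]
    rw [gen_mul_comm_of_ne hab, map_add, add_mul, map_add, add_sub_cancel_left, map_sub, sub_mul,
      hdiag, hdiag, map_sub, map_smul, map_smul, htr]
    simp
  · ext μ
    simp only [coeff_wtDeriv, hT, t, coeff_character]
    rw [map_mul ρ, mul_assoc, hdiag, mul_smul_comm, hdiag, map_smul, map_smul, htr]
    simp
  · ext μ
    simp only [hT, t, gen_self_swap, zero_mul, map_zero]
    rfl
  · ext μ
    simp only [AddMonoidAlgebra.coeff_sum, Finsupp.finsetSum_apply, hT, t,
      AddMonoidAlgebra.coeff_smul_apply, coeff_character]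
    simp only [← map_sum, ← Finset.sum_mul]
    rw [← casimir, hcas, map_smul, htr]

end Characters

end TypeD

end

noncomputable section

namespace TypeD

/-! ### The Weyl character formula -/

theorem wtDeriv_inr {n : ℕ} (i : Fin n) (f : CExp n) :
    wtDeriv (.inr i) f = -wtDeriv (.inl i) f := by
  ext ν
  simp [coeff_wtDeriv]

theorem yElt_sub_ne_zero {n : ℕ} {i j : Fin n} (h : i ≠ j) : yElt i - yElt j ≠ (0 : CExp n) := by
  intro h0
  have h1 : ∀ k : Fin n, (mono (Pi.single k 1)).coeff (Pi.single i 1) =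
      if k = i then (1 : ℂ) else 0 := by
    intro k
    rw [coeff_mono]
    congr 1
    refine propext ⟨fun h => ?_, fun h => h ▸ rfl⟩
    by_contra hk
    simpa [hk] using congrFun h k
  have h2 : ∀ k : Fin n, (mono (-Pi.single k 1)).coeff (Pi.single i 1) = (0 : ℂ) := by
    intro k
    rw [coeff_mono, if_neg]
    intro h
    have := congrFun h i
    by_cases hk : i = k <;> simp [hk] at this
  have := congrArg (fun f : CExp n => f.coeff (wt (.inl i))) h0
  simp [yElt, h1, h2, h.symm] at this

theorem wtDeriv_yElt {n : ℕ} (i j : Fin n) : wtDeriv (.inl i) (yElt j) =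
    if i = j then mono (wt (.inl i)) - mono (wt (.inr i)) else (0 : CExp n) := by
  rw [yElt, map_add, wtDeriv, deriv_mono, deriv_mono]
  simp only [dotHom, AddMonoidHom.coe_mk, ZeroHom.coe_mk]
  split_ifs with h
  · subst h; simp [sub_eq_add_neg]
  · simp [h]

/-- The Laplace operator `e^ν ↦ (ν, ν) e^ν`. -/
def laplace {n : ℕ} (f : CExp n) : CExp n := ∑ i, wtDeriv (.inl i) (wtDeriv (.inl i) f)

theorem coeff_laplace {n : ℕ} (f : CExp n) (ν : Fin n → ℤ) :
    (laplace f).coeff ν = ((ν ⬝ᵥ ν : ℤ) : ℂ) * f.coeff ν := by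
  simp only [laplace, AddMonoidAlgebra.coeff_sum, Finsupp.finsetSum_apply, coeff_wtDeriv]
  simp only [wt_inl, dotProduct_single, mul_one]
  simp only [dotProduct, Int.cast_sum, Int.cast_mul, Finset.sum_mul, mul_assoc]

/-- The derivation `g ↦ ∑_i ∂_i f ∂_i g`. -/
def gradDeriv {n : ℕ} (f : CExp n) : Derivation ℂ (CExp n) (CExp n) :=
  ∑ i, wtDeriv (.inl i) f • wtDeriv (.inl i)

theorem gradDeriv_apply {n : ℕ} (f g : CExp n) :
    gradDeriv f g = ∑ i, wtDeriv (.inl i) f * wtDeriv (.inl i) g := by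
  rw [gradDeriv, ← Derivation.coeFnAddMonoidHom_apply, map_sum, Finset.sum_apply]
  rfl

theorem laplace_mul {n : ℕ} (f g : CExp n) :
    laplace (f * g) = f * laplace g + g * laplace f + 2 * gradDeriv g f := by
  simp only [laplace, gradDeriv_apply, Finset.mul_sum, ← Finset.sum_add_distrib]
  refine Finset.sum_congr rfl fun i _ => ?_
  simp only [Derivation.leibniz, map_add, smul_eq_mul]
  ring

theorem gradDeriv_yElt_sub {n : ℕ} (f : CExp n) (i j : Fin n) :
    gradDeriv f (yElt j - yElt i) =
      wtDeriv (.inl j) f * (mono (wt (.inl j)) - mono (wt (.inr j))) -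
      wtDeriv (.inl i) f * (mono (wt (.inl i)) - mono (wt (.inr i))) := by
  simp only [map_sub, gradDeriv_apply, wtDeriv_yElt]
  simp

theorem derivation_prod {R A ι : Type*} [CommRing R] [CommRing A] [Algebra R A]
    (D : Derivation R A A) (s : Finset ι) {f g : ι → A} (h : ∀ i ∈ s, 2 * D (f i) = f i * g i) :
    2 * D (∏ i ∈ s, f i) = (∏ i ∈ s, f i) * ∑ i ∈ s, g i := by
  classical
  induction s using Finset.induction_on with
  | empty => simp
  | insert i s hi ih =>
    rw [Finset.prod_insert hi, Finset.sum_insert hi, Derivation.leibniz, smul_eq_mul, smul_eq_mul]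
    linear_combination (f i) * ih (fun j hj => h j (Finset.mem_insert_of_mem hj)) +
      (∏ j ∈ s, f j) * h i (Finset.mem_insert_self i s)

section Weyl

variable {n : ℕ} {V : Type*} [AddCommGroup V] [Module ℂ V] [Module (U n) V]
  [IsScalarTower ℂ (U n) V] {lam : Fin n → ℤ} {v : V}

theorem exists_casimir_smul (hv : IsHighest lam v) (hgen : ∀ w : V, ∃ u : U n, u • v = w) :
    ∃ c : ℂ, ∀ w : V, casimir n • w = c • w := by
  have h : casimir n • v ∈ wtSpace V lam := by
    simp only [casimir, Finset.sum_smul, mul_smul]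
    refine sum_mem fun a _ => sum_mem fun b _ => ?_
    have := gen_smul_mem (gen_smul_mem hv.1 b a) a b
    rwa [show lam + (wt b - wt a) + (wt a - wt b) = lam by abel] at this
  rw [wtSpace_self_eq hv hgen, Submodule.mem_span_singleton] at h
  obtain ⟨c, hc⟩ := h
  refine ⟨c, fun w => ?_⟩
  obtain ⟨u, rfl⟩ := hgen w
  rw [← mul_smul, ← mul_casimir, mul_smul, ← hc, smul_comm]

variable [Module.Finite ℂ V]

/-- Write δ = `alternant rho` and let Q_{ij} gather the traces of the four roots ±ε_i ± ε_j. The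
trace relations say (y_i - y_j) Q_{ij} = 2 ∇ch · ∇(y_i - y_j), so by the product formula 2 ∇ch · ∇δ
= δ Σ_{i<j} Q_{ij}. The Casimir relation gives Σ_{i<j} Q_{ij} = (c/2) ch - Δch. In Δ(δ ch) = δ Δch +
ch Δδ + 2 ∇ch · ∇δ the terms δ Δch cancel, and Δδ = (ρ, ρ) δ. -/
theorem exists_laplace_alternant_mul (hv : IsHighest lam v)
    (hgen : ∀ w : V, ∃ u : U n, u • v = w) :
    ∃ c : ℂ, laplace (alternant rho * character (n := n) V) =
      c • (alternant rho * character V) := by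
  obtain ⟨c, hc⟩ := exists_casimir_smul hv hgen
  obtain ⟨T, hT, hTsub, hTdiag, hTswap, hTsum⟩ :=
    exists_traces (iSup_wtSpace_eq_top hv hgen) hc
  set ch : CExp n := character V
  let Q : Fin n → Fin n → CExp n := fun i j =>
    T (.inl i) (.inl j) + T (.inl i) (.inr j) + T (.inr i) (.inl j) + T (.inr i) (.inr j)
  have hxX : ∀ i : Fin n, (mono (wt (.inl i)) : CExp n) * mono (wt (.inr i)) = 1 := by
    intro i
    rw [mono_mul, ← mono_zero]
    simp
  have hT' : ∀ a b, b ≠ a.swap → (mono (wt a) - mono (wt b)) * T a b =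
      mono (wt a) * (wtDeriv a ch - wtDeriv b ch) := by
    intro a b hab
    have h1 : mono (wt b) * T a b = mono (wt a) * T b a := by
      rw [hT a b, ← mul_assoc, mono_mul]
      congr 2
      abel
    linear_combination mono (wt a) * hTsub a b hab - h1
  have hQ : ∀ i j : Fin n, i ≠ j → (yElt i - yElt j) * Q i j =
      2 * ((mono (wt (.inl i)) - mono (wt (.inr i))) * wtDeriv (.inl i) ch -
        (mono (wt (.inl j)) - mono (wt (.inr j))) * wtDeriv (.inl j) ch) := by
    intro i j hij
    have h1 := hT' (.inl i) (.inl j) (by simp)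
    have h2 := hT' (.inl i) (.inr j) (by simpa using hij.symm)
    have h3 := hT' (.inr i) (.inl j) (by simpa using hij.symm)
    have h4 := hT' (.inr i) (.inr j) (by simp)
    have hi := hxX i
    have hj := hxX j
    simp only [wtDeriv_inr] at h1 h2 h3 h4
    simp only [yElt, Q]
    generalize mono (wt (Sum.inl i)) = x at *
    generalize mono (wt (Sum.inr i)) = X at *
    generalize mono (wt (Sum.inl j)) = y at *
    generalize mono (wt (Sum.inr j)) = Y at *
    generalize wtDeriv (.inl i) ch = A at *
    generalize wtDeriv (.inl j) ch = B at *
    generalize T (.inl i) (.inl j) = t₁ at *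
    generalize T (.inl i) (.inr j) = t₂ at *
    generalize T (.inr i) (.inl j) = t₃ at *
    generalize T (.inr i) (.inr j) = t₄ at *
    -- Since xX = yY = 1, the difference y_i - y_j factors as (x - y)(1 - XY); the other three
    -- identities exchange x with X or y with Y.
    have e1 : (x + X - (y + Y)) * t₁ = (x - Y) * (A - B) := by
      linear_combination (1 - X * Y) * h1 + (Y * t₁ - Y * (A - B)) * hi - X * t₁ * hj
    have e2 : (x + X - (y + Y)) * t₂ = (x - y) * (A + B) := by
      linear_combination (1 - X * y) * h2 + (y * t₂ - y * (A + B)) * hi - X * t₂ * hj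
    have e3 : (x + X - (y + Y)) * t₃ = (X - Y) * (-A - B) := by
      linear_combination (1 - x * Y) * h3 + (Y * t₃ - Y * (-A - B)) * hi - x * t₃ * hj
    have e4 : (x + X - (y + Y)) * t₄ = (X - y) * (-A + B) := by
      linear_combination (1 - x * y) * h4 + (y * t₄ - y * (-A + B)) * hi - x * t₄ * hj
    linear_combination e1 + e2 + e3 + e4
  have hQsymm : ∀ i j : Fin n, i ≠ j → Q j i = Q i j := by
    intro i j hij
    refine mul_left_cancel₀ (yElt_sub_ne_zero hij) ?_
    linear_combination -(hQ j i hij.symm) - hQ i j hij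
  have hQdiag : ∀ i, Q i i = 2 * wtDeriv (.inl i) (wtDeriv (.inl i) ch) := by
    intro i
    have h1 : T (.inl i) (.inr i) = 0 := hTswap (.inl i)
    have h2 : T (.inr i) (.inl i) = 0 := hTswap (.inr i)
    simp only [Q, h1, h2, hTdiag, wtDeriv_inr, map_neg, neg_neg]
    ring
  have hsum : c • ch = 2 * laplace ch + 2 * ∑ i, ∑ j ∈ Finset.Ioi i, Q i j := by
    rw [← hTsum]
    have h1 : ∑ a, ∑ b, T a b = ∑ i, ∑ j, Q i j := by
      simp only [Fintype.sum_sum_type, Q, Finset.sum_add_distrib]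
      abel
    have h2 : ∑ i, ∑ j, Q i j = ∑ i, Q i i + ∑ i, ∑ j ∈ Finset.Ioi i, (Q j i + Q i j) := by
      rw [Finset.sum_sum_Ioi_add_eq_sum_sum_off_diag, ← Finset.sum_add_distrib]
      refine Finset.sum_congr rfl fun i _ => ?_
      rw [← Finset.add_sum_erase _ _ (Finset.mem_univ i), Finset.compl_singleton]
      refine congrArg₂ _ rfl (Finset.sum_congr rfl fun j hj => ?_)
      exact hQsymm j i (Finset.ne_of_mem_erase hj)
    rw [h1, h2, laplace, Finset.mul_sum, Finset.mul_sum]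
    congr 1
    · exact Finset.sum_congr rfl fun i _ => hQdiag i
    · refine Finset.sum_congr rfl fun i _ => ?_
      rw [Finset.mul_sum]
      refine Finset.sum_congr rfl fun j hj => ?_
      rw [hQsymm i j (Finset.mem_Ioi.1 hj).ne, two_mul]
  have hgrad : 2 * gradDeriv ch (alternant rho) =
      alternant rho * ∑ i, ∑ j ∈ Finset.Ioi i, Q i j := by
    obtain ⟨κ, hκ⟩ := alternant_rho_eq (n := n)
    have := derivation_prod (gradDeriv ch) Finset.univ
      (f := fun i : Fin n => ∏ j ∈ Finset.Ioi i, (yElt j - yElt i))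
      (g := fun i => ∑ j ∈ Finset.Ioi i, Q i j)
      fun i _ => derivation_prod (gradDeriv ch) (Finset.Ioi i) fun j hj => by
        rw [gradDeriv_yElt_sub]
        linear_combination hQ i j (Finset.mem_Ioi.1 hj).ne
    rw [hκ, ← Algebra.smul_def, (gradDeriv ch).map_smul, mul_smul_comm, this, smul_mul_assoc]
  have hlap : laplace (alternant rho : CExp n) =
      (((rho : Fin n → ℤ) ⬝ᵥ rho : ℤ) : ℂ) • alternant rho := by
    ext ν
    rw [coeff_laplace, AddMonoidAlgebra.coeff_smul_apply, smul_eq_mul]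
    by_cases h : (alternant rho).coeff ν = 0
    · rw [h, mul_zero, mul_zero]
    · rw [alternant_norm h]
  refine ⟨(((rho : Fin n → ℤ) ⬝ᵥ rho : ℤ) : ℂ) + c / 2, ?_⟩
  rw [laplace_mul, hgrad, hlap, add_smul]
  have h3 : (c / 2) • ch = laplace ch + ∑ i, ∑ j ∈ Finset.Ioi i, Q i j := by
    rw [div_eq_inv_mul, mul_smul, hsum, ← mul_add, two_mul, ← two_smul ℂ, smul_smul,
      inv_mul_cancel₀ two_ne_zero, one_smul]
  rw [← mul_smul_comm (c / 2), h3, mul_smul_comm, mul_add, mul_comm ch (alternant rho)]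
  abel

theorem lowerBy_character (hv : IsHighest lam v) (hgen : ∀ w : V, ∃ u : U n, u • v = w) :
    LowerBy lam (character (n := n) V) := by
  intro ν h
  refine sub_mem_posCone_of_wtSpace_ne_bot hv hgen fun h0 => h ?_
  rw [coeff_character, h0, finrank_bot, Nat.cast_zero]

theorem coeff_character_self (hv : IsHighest lam v) (hgen : ∀ w : V, ∃ u : U n, u • v = w)
    (h0 : v ≠ 0) : (character (n := n) V).coeff lam = 1 := by
  rw [coeff_character, wtSpace_self_eq hv hgen, finrank_span_singleton h0, Nat.cast_one]

theorem refl_add (a b : Fin n ⊕ Fin n) (μ ν : Fin n → ℤ) :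
    refl a b (μ + ν) = refl a b μ + refl a b ν := by
  simp only [refl, add_dotProduct, add_smul]
  abel

/-- The reflection acts on the exponents of both factors, so the convolution sum is reindexed by it.
-/
theorem IsAlt.mul {f g : CExp n} (hf : IsAlt f)
    (hg : ∀ a b : Fin n ⊕ Fin n, b ≠ a → b ≠ a.swap → ∀ ν, g.coeff (refl a b ν) = g.coeff ν) :
    IsAlt (f * g) := by
  intro a b h h' ν
  rw [AddMonoidAlgebra.coeff_mul_apply_left, AddMonoidAlgebra.coeff_mul_apply_left, Finsupp.sum,
    Finsupp.sum, ← Finset.sum_neg_distrib]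
  refine Finset.sum_nbij' (refl a b) (refl a b) ?_ ?_ (fun μ _ => refl_refl h h' μ)
    (fun μ _ => refl_refl h h' μ) ?_
  · intro μ hμ
    rw [Finsupp.mem_support_iff] at hμ ⊢
    rwa [hf a b h h', neg_ne_zero]
  · intro μ hμ
    rw [Finsupp.mem_support_iff] at hμ ⊢
    rwa [hf a b h h', neg_ne_zero]
  · intro μ _
    rw [hf a b h h' μ]
    have : -μ + refl a b ν = refl a b (-refl a b μ + ν) := by
      have := refl_add a b (-μ) ν
      have h1 : refl a b (-refl a b μ) = -μ := by
        have h2 := refl_add a b (-refl a b μ) (refl a b μ)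
        rw [refl_refl h h' μ] at h2
        have h3 : refl a b (-refl a b μ + refl a b μ) = 0 := by simp [refl]
        rw [h3] at h2
        exact (neg_eq_of_add_eq_zero_left h2.symm).symm
      rw [refl_add, h1]
    rw [this, hg a b h h']
    ring

theorem isAlt_alternant_mul_character : IsAlt (alternant rho * character (n := n) V) := by
  refine (isAlt_alternant _).mul fun a b h h' ν => ?_
  rw [coeff_character, coeff_character, finrank_wtSpace_refl h h']

end Weyl

theorem coeff_alternant_rho {n : ℕ} (hn : 0 < n) : (alternant (rho : Fin n → ℤ)).coeff rho = 2 := by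
  obtain ⟨n, rfl⟩ := Nat.exists_eq_succ_of_ne_zero hn.ne'
  rw [coeff_alternant_of_last_eq_zero strictDom_rho strictDom_rho (by simp [rho]), if_pos rfl]

section Weyl

variable {n : ℕ} {V : Type*} [AddCommGroup V] [Module ℂ V] [Module (U n) V]
  [IsScalarTower ℂ (U n) V] {lam : Fin n → ℤ} {v : V} [Module.Finite ℂ V]

/-- The Weyl character formula: the dominant part of the product of the Weyl denominator with the
character. -/
theorem coeff_alternant_mul_character (hn : 0 < n) (hv : IsHighest lam v)
    (hgen : ∀ w : V, ∃ u : U n, u • v = w) (h0 : v ≠ 0) (hlam : StrictDom (lam + rho))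
    {ν : Fin n → ℤ} (hν : StrictDom ν) :
    (alternant rho * character V).coeff ν = if ν = lam + rho then 2 else 0 := by
  obtain ⟨c, hc⟩ := exists_laplace_alternant_mul hv hgen
  have hlow := lowerBy_alternant_rho.mul (lowerBy_character hv hgen)
  have hone : (alternant rho * character V).coeff (lam + rho) = 2 := by
    rw [add_comm, lowerBy_alternant_rho.coeff_mul (lowerBy_character hv hgen),
      coeff_alternant_rho hn, coeff_character_self hv hgen h0, mul_one]
  -- The Laplace operator scales e^ν by (ν, ν), so all exponents of an eigenvector share one norm.
  have hnorm : ∀ ν : Fin n → ℤ, (alternant rho * character V).coeff ν ≠ 0 →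
      ((ν ⬝ᵥ ν : ℤ) : ℂ) = c := by
    intro ν h
    have := congrArg (fun f : CExp n => f.coeff ν) hc
    simp only [coeff_laplace, AddMonoidAlgebra.coeff_smul_apply, smul_eq_mul] at this
    exact mul_right_cancel₀ h this
  split_ifs with h
  · rw [h, hone]
  · by_contra hne
    refine h (hlam.eq_of_norm_eq hν ?_ ?_)
    · rw [add_comm]
      exact hlow ν hne
    · have h1 := hnorm ν hne
      rw [← hnorm (lam + rho) (by rw [hone]; exact two_ne_zero)] at h1
      exact_mod_cast h1.symm

end Weyl

end TypeD

end

noncomputable section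

namespace TypeD

theorem rho_last {n : ℕ} : rho (Fin.last n) = 0 := by
  simp [rho]

section Weyl

variable {n : ℕ} {V : Type*} [AddCommGroup V] [Module ℂ V] [Module (U (n + 1)) V]
  [IsScalarTower ℂ (U (n + 1)) V] {lam : Fin (n + 1) → ℤ} {v : V} [Module.Finite ℂ V]

/-- Both sides are alternating and have the single strictly dominant exponent λ+ρ with coefficient
2. -/
theorem alternant_mul_character_of_last_eq_zero (hv : IsHighest lam v)
    (hgen : ∀ w : V, ∃ u : U (n + 1), u • v = w) (h0 : v ≠ 0) (hlam : StrictDom (lam + rho))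
    (hlast : lam (Fin.last n) = 0) :
    alternant rho * character V = alternant (lam + rho) := by
  rw [← sub_eq_zero, sub_eq_add_neg, ← neg_one_smul ℂ (alternant (lam + rho))]
  refine IsAlt.eq_zero (isAlt_alternant_mul_character.add ((isAlt_alternant _).smul _))
    fun ν hν => ?_
  rw [AddMonoidAlgebra.coeff_add, Finsupp.add_apply, AddMonoidAlgebra.coeff_smul_apply,
    coeff_alternant_mul_character n.succ_pos hv hgen h0 hlam hν,
    coeff_alternant_of_last_eq_zero hlam hν (by rw [Pi.add_apply, hlast, rho_last, add_zero])]
  split_ifs <;> simp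

/-- The alternant of λ+ρ sees both strictly dominant exponents λ+ρ and λ'+ρ with coefficient 1,
while each product on the left contributes one of them with coefficient 2. Only the sum of the two
characters is thus accessible. -/
theorem alternant_mul_character_add_of_last_ne_zero {V' : Type*} [AddCommGroup V'] [Module ℂ V']
    [Module (U (n + 1)) V'] [IsScalarTower ℂ (U (n + 1)) V'] {lam' : Fin (n + 1) → ℤ} {v' : V'}
    [Module.Finite ℂ V'] (hv : IsHighest lam v)
    (hgen : ∀ w : V, ∃ u : U (n + 1), u • v = w) (h0 : v ≠ 0) (hlam : StrictDom (lam + rho))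
    (hv' : IsHighest lam' v') (hgen' : ∀ w : V', ∃ u : U (n + 1), u • v' = w) (h0' : v' ≠ 0)
    (hlam' : StrictDom (lam' + rho)) (hlast : lam (Fin.last n) ≠ 0)
    (heq : lam' = Function.update lam (Fin.last n) (-lam (Fin.last n))) :
    alternant rho * (character V + character V') = (2 : ℂ) • alternant (lam + rho) := by
  rw [← sub_eq_zero, sub_eq_add_neg, ← neg_smul, mul_add]
  refine IsAlt.eq_zero ((isAlt_alternant_mul_character.add isAlt_alternant_mul_character).add
    ((isAlt_alternant _).smul _)) fun ν hν => ?_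
  have hne : lam + rho ≠ lam' + rho := by
    intro h
    have := congrFun ((add_right_cancel h).trans heq) (Fin.last n)
    rw [Function.update_self] at this
    exact hlast (self_eq_neg.1 this)
  have heq' : lam' + rho =
      Function.update (lam + rho) (Fin.last n) (-(lam + rho : Fin (n + 1) → ℤ) (Fin.last n)) := by
    ext i
    by_cases hi : i = Fin.last n
    · subst hi; simp [heq, rho_last]
    · simp [heq, hi]
  rw [AddMonoidAlgebra.coeff_add, Finsupp.add_apply, AddMonoidAlgebra.coeff_smul_apply,
    AddMonoidAlgebra.coeff_add, Finsupp.add_apply,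
    coeff_alternant_mul_character n.succ_pos hv hgen h0 hlam hν,
    coeff_alternant_mul_character n.succ_pos hv' hgen' h0' hlam' hν,
    coeff_alternant_of_last_ne_zero hlam hν
      (by rwa [Pi.add_apply, rho_last, add_zero]), ← heq']
  by_cases h1 : ν = lam + rho
  · rw [if_pos h1, if_neg (h1 ▸ hne), if_pos (Or.inl h1)]
    simp
  · by_cases h2 : ν = lam' + rho
    · rw [if_neg h1, if_pos h2, if_pos (Or.inr h2)]
      simp
    · rw [if_neg h1, if_neg h2, if_neg (by tauto)]
      simp

end Weyl

/-! ### Characters in the field of formal exponentials -/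

/-- The inclusion of the group ring with complex coefficients. -/
def toExpField (n : ℕ) : CExp n →+* ExpField n :=
  (algebraMap (ExpRing n) (ExpField n)).comp
    (AddMonoidAlgebra.mapRingHom (Fin n → ℤ) (algebraMap ℂ K))

theorem toExpField_mono {n : ℕ} (μ : Fin n → ℤ) : toExpField n (mono μ) = e μ := by
  simp [toExpField, mono, e]

theorem toExpField_injective (n : ℕ) : Function.Injective (toExpField n) := by
  refine (IsFractionRing.injective (ExpRing n) (ExpField n)).comp ?_
  intro f g h
  ext ν
  have := congrArg (fun f : ExpRing n => f.coeff ν) h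
  exact (algebraMap ℂ K).injective (by simpa using this)

theorem weightSpace_eq {n : ℕ} (lam μ : Fin n → ℤ) : weightSpace lam μ = wtSpace (L lam) μ := by
  ext v
  change (∀ i, toU (cartan i) • v = algebraMap ℂ (U n) (μ i : ℂ) • v) ↔ _
  rw [mem_wtSpace]
  refine forall_congr' fun i => ?_
  rw [cartan_eq, algebraMap_smul]
  rfl

theorem chi_eq {n : ℕ} (lam : Fin n → ℤ) [Module.Finite ℂ (L lam)] :
    chi lam = toExpField n (character (L lam)) := by
  have h1 : ∀ f : CExp n, toExpField n f =
      ∑ μ ∈ f.coeff.support, toExpField n (algebraMap ℂ _ (f.coeff μ)) * e μ := by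
    intro f
    conv_lhs => rw [← AddMonoidAlgebra.sum_coeff_single f, Finsupp.sum, map_sum]
    refine Finset.sum_congr rfl fun μ _ => ?_
    rw [← toExpField_mono, ← map_mul, ← Algebra.smul_def, mono, AddMonoidAlgebra.smul_single,
      smul_eq_mul, mul_one]
  rw [h1, chi, finsum_eq_sum_of_support_subset]
  · refine Finset.sum_congr rfl fun μ _ => ?_
    rw [weightSpace_eq, coeff_character, map_natCast, map_natCast]
  · intro μ hμ
    rw [Function.mem_support, weightSpace_eq] at hμ
    rw [Finset.mem_coe, Finsupp.mem_support_iff, coeff_character]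
    refine Nat.cast_ne_zero.2 fun h => left_ne_zero_of_mul hμ ?_
    rw [h, Nat.cast_zero]

/-- The formal exponentials `e^{ε_i}`. -/
def expVar (n : ℕ) (i : Fin n) : ExpField n := e (Pi.single i 1)

theorem e_add {n : ℕ} (μ ν : Fin n → ℤ) : e (μ + ν) = e μ * e ν := by
  rw [← toExpField_mono, ← mono_mul, map_mul, toExpField_mono, toExpField_mono]

theorem e_ne_zero {n : ℕ} (μ : Fin n → ℤ) : e μ ≠ 0 := by
  intro h
  have := e_add μ (-μ)
  rw [h, zero_mul, add_neg_cancel, ← toExpField_mono, mono_zero, map_one] at this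
  exact one_ne_zero this

theorem e_neg {n : ℕ} (μ : Fin n → ℤ) : e (-μ) = (e μ)⁻¹ := by
  refine eq_inv_of_mul_eq_one_left ?_
  rw [← e_add, neg_add_cancel, ← toExpField_mono, mono_zero,
    map_one]

theorem e_single {n : ℕ} (i : Fin n) (z : ℤ) : e (Pi.single i z) = expVar n i ^ z := by
  have h : ∀ k : ℕ, e (Pi.single i (k : ℤ)) = expVar n i ^ k := by
    intro k
    induction k with
    | zero => rw [Nat.cast_zero, Pi.single_zero, ← toExpField_mono, mono_zero, map_one, pow_zero]
    | succ k ih => rw [Nat.cast_succ, Pi.single_add, e_add, ih, pow_succ, expVar]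
  obtain ⟨k, rfl | rfl⟩ := z.eq_nat_or_neg
  · rw [h, zpow_natCast]
  · rw [Pi.single_neg, e_neg, h, zpow_neg, zpow_natCast]

theorem toExpField_alternant {n : ℕ} (m : Fin n → ℤ) :
    toExpField n (alternant m) = (expMat (expVar n) m).det := by
  rw [alternant, RingHom.map_det]
  congr 1
  ext i c
  simp [expMat, symPow, toExpField_mono, e_single]

theorem det_expMat_rho_ne_zero {n : ℕ} (hn : 0 < n) : (expMat (expVar n) rho).det ≠ 0 := by
  rw [← toExpField_alternant]
  refine (map_ne_zero_iff _ (toExpField_injective n)).2 fun h => ?_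
  have := coeff_alternant_rho hn
  rw [h] at this
  simp at this

section Simple

variable {n : ℕ} {lam : Fin n → ℤ}

theorem HasHighest.isHighest (h : HasHighest lam) : IsHighest lam ((maxIdeal lam).mkQ 1) :=
  isHighest_mkQ_one (vermaIdeal_le_maxIdeal h.vermaIdeal_ne_top_and_finite.1)

theorem HasHighest.mkQ_one_ne_zero (h : HasHighest lam) : (maxIdeal lam).mkQ 1 ≠ 0 := by
  intro h0
  refine maxIdeal_ne_top h.vermaIdeal_ne_top_and_finite.1 ?_
  have : (1 : U n) ∈ maxIdeal lam := (Submodule.Quotient.mk_eq_zero _).1 h0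
  exact (Ideal.eq_top_iff_one _).2 this

end Simple

theorem det_mul_chi_of_last_eq_zero {n : ℕ} {lam : Fin (n + 1) → ℤ} (h : HasHighest lam)
    (hlam : StrictDom (lam + rho)) (hlast : lam (Fin.last n) = 0) :
    (expMat (expVar (n + 1)) rho).det * chi lam = (expMat (expVar (n + 1)) (lam + rho)).det := by
  have := h.vermaIdeal_ne_top_and_finite.2
  rw [← toExpField_alternant, ← toExpField_alternant, chi_eq, ← map_mul,
    alternant_mul_character_of_last_eq_zero h.isHighest (exists_smul_mkQ_one _) h.mkQ_one_ne_zero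
      hlam hlast]

theorem det_mul_chi_add_of_last_ne_zero {n : ℕ} {lam lam' : Fin (n + 1) → ℤ} (h : HasHighest lam)
    (hlam : StrictDom (lam + rho)) (h' : HasHighest lam') (hlam' : StrictDom (lam' + rho))
    (hlast : lam (Fin.last n) ≠ 0)
    (heq : lam' = Function.update lam (Fin.last n) (-lam (Fin.last n))) :
    (expMat (expVar (n + 1)) rho).det * (chi lam + chi lam') =
      2 * (expMat (expVar (n + 1)) (lam + rho)).det := by
  have := h.vermaIdeal_ne_top_and_finite.2
  have := h'.vermaIdeal_ne_top_and_finite.2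
  rw [← toExpField_alternant, ← toExpField_alternant, chi_eq, chi_eq, ← map_add, ← map_mul,
    alternant_mul_character_add_of_last_ne_zero h.isHighest (exists_smul_mkQ_one _)
      h.mkQ_one_ne_zero hlam h'.isHighest (exists_smul_mkQ_one _) h'.mkQ_one_ne_zero hlam' hlast
      heq, two_smul, map_add, two_mul]

end TypeD

end

noncomputable section

namespace TypeD

/-! ### Hook weights -/

theorem sum_single_castLE {n s : ℕ} (h : s ≤ n) (i : Fin n) :
    (∑ p : Fin s, (Pi.single (Fin.castLE h p) 1 : Fin n → ℤ)) i =
      if (i : ℕ) < s then 1 else 0 := by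
  rw [Finset.sum_apply]
  split_ifs with hi
  · rw [Finset.sum_eq_single ⟨i, hi⟩]
    · simp [Fin.castLE]
    · intro p _ hp
      rw [Pi.single_eq_of_ne]
      rintro rfl
      exact hp rfl
    · simp
  · refine Finset.sum_eq_zero fun p _ => Pi.single_eq_of_ne ?_ _
    rintro rfl
    exact hi p.2

theorem HasHighest.add_single {n : ℕ} {lam : Fin (n + 1) → ℤ} (h : HasHighest lam) (k : ℕ) :
    HasHighest (lam + Pi.single 0 (k : ℤ)) := by
  have h1 : HasHighest (Pi.single 0 1 : Fin (n + 1) → ℤ) := by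
    have := hasHighest_of_injective (n := n + 1) (m := 1) (c := fun _ => .inl 0)
      (fun _ _ _ => Subsingleton.elim _ _) fun p a ha => by
        exfalso
        rcases a with i | i <;> simp [rho] at ha <;> omega
    simpa using this
  induction k with
  | zero => simpa using h
  | succ k ih =>
    have := ih.add h1
    rwa [add_assoc, ← Pi.single_add, ← Nat.cast_succ] at this

/-- The weight is ε_1 + ⋯ + ε_{r̄+1} from an exterior power, plus k - r - 1 copies of ε_1 from the
natural module. -/
theorem hasHighest_hook {n k r : ℕ} (hr : r < k) : HasHighest (hook (n + 1) k r) := by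
  have hs : min r (2 * (n + 1) - 2 - r) + 1 ≤ n + 1 := by omega
  have h := (hasHighest_of_injective (c := fun p => .inl (Fin.castLE hs p))
    (fun p p' h => Fin.castLE_injective hs (Sum.inl_injective h)) fun p a ha => by
      rcases a with i | i
      · simp [rho] at ha
        exact ⟨⟨i, by omega⟩, rfl⟩
      · simp [rho] at ha
        omega).add_single (k - r - 1)
  convert h using 1
  ext i
  rw [Pi.add_apply]
  simp only [wt_inl]
  rw [sum_single_castLE, hook]
  by_cases hi : i = 0
  · subst hi
    simp
    omega
  · have : (i : ℕ) ≠ 0 := fun h => hi (Fin.ext h)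
    simp [hi]

theorem hasHighest_hookBar {n k : ℕ} (hn : n ≠ 0) (hk : n < k) :
    HasHighest (hookBar (n + 1) k) := by
  have h := (hasHighest_of_injective (n := n + 1) (m := n + 1)
    -- The indices 1, …, n together with the negative of the last one are closed upwards, because
    -- ±ε_{n+1} have the same ρ-height 0.
    (c := fun p => if p = Fin.last n then .inr p else .inl p)
    (fun p p' h => by
      dsimp only at h
      split_ifs at h
      · exact Sum.inr_injective h
      · exact Sum.inl_injective h) fun p a ha => by
      have hp := p.2
      rcases a with i | i
      · refine ⟨i, if_neg ?_⟩
        rintro rfl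
        split_ifs at ha with h
        · simp [h, rho] at ha
        · simp [rho] at ha
          omega
      · refine ⟨i, if_pos (Fin.ext ?_)⟩
        have hi := i.2
        rw [Fin.val_last]
        split_ifs at ha with h
        · simp [h, rho] at ha
          omega
        · simp [rho] at ha
          omega).add_single (k - n - 1)
  convert h using 1
  ext i
  rw [Pi.add_apply, Finset.sum_apply, Finset.sum_eq_single i]
  · simp only [hookBar]
    by_cases hi : i = Fin.last n
    · subst hi
      simp [hn, Fin.ext_iff]
    · have h1 : (i : ℕ) ≠ n := fun h => hi (Fin.ext h)
      rw [if_neg hi]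
      by_cases h0 : i = 0
      · subst h0
        simp
        omega
      · have : (i : ℕ) ≠ 0 := fun h => h0 (Fin.ext h)
        simp [this, h1, h0]
  · intro p _ hp
    split_ifs <;> simp [hp.symm]
  · simp

theorem strictDom_of_antitone {n : ℕ} {lam : Fin n → ℤ} (h : ∀ i j, i < j → |lam j| ≤ lam i) :
    StrictDom (lam + rho) := by
  refine strictDom_of_abs_lt fun i j hij => ?_
  have h1 := h i j hij
  have hlt : (i : ℕ) < j := hij
  have hj := j.2
  rw [Pi.add_apply, Pi.add_apply]
  refine (abs_add_le _ _).trans_lt ?_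
  simp only [rho]
  rw [abs_of_nonneg (a := (n : ℤ) - 1 - j) (by omega)]
  omega

theorem strictDom_hook {n k r : ℕ} (hr : r < k) : StrictDom (hook n k r + rho) := by
  refine strictDom_of_antitone fun i j hij => ?_
  have hlt : (i : ℕ) < j := hij
  rw [abs_le]
  simp only [hook]
  split_ifs <;> omega

theorem strictDom_hookBar {n k : ℕ} (hk : n ≤ k) : StrictDom (hookBar n k + rho) := by
  refine strictDom_of_antitone fun i j hij => ?_
  have hlt : (i : ℕ) < j := hij
  have := j.2
  rw [abs_le]
  simp only [hookBar]
  split_ifs <;> omega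

theorem hookBar_eq_update {n k : ℕ} (hn : n ≠ 0) : hookBar (n + 1) k =
    Function.update (hook (n + 1) k n) (Fin.last n) (-hook (n + 1) k n (Fin.last n)) := by
  ext i
  by_cases hi : i = Fin.last n
  · subst hi
    rw [Function.update_self]
    simp only [hook, hookBar, Fin.val_last]
    split_ifs <;> omega
  · have h1 : (i : ℕ) ≠ n := fun h => hi (Fin.ext h)
    have h2 := i.2
    rw [Function.update_of_ne hi]
    simp only [hook, hookBar]
    split_ifs <;> omega

end TypeD

end

/-! ### Matching the determinants with hook weights; the rank is n + 1, so 2n stands for the 2n - 2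
of the theorem -/

noncomputable section

namespace TypeD

/-! ### Determinants with one column of `ρ` replaced -/

section Determinants

variable {F : Type*} [Field F] {n : ℕ} (x : Fin n → F)

theorem det_expMat_update_neg (c : Fin n) (m : ℤ) :
    (expMat x (Function.update rho c (-m))).det = (expMat x (Function.update rho c m)).det := by
  simp only [expMat_update, symPow_neg]

theorem det_expMat_update_of_abs_eq {c : Fin n} {m : ℤ} (h : |m| = rho c) :
    (expMat x (Function.update rho c m)).det = (expMat x rho).det := by
  rcases abs_choice m with h' | h'
  · rw [← h', h, Function.update_eq_self]
  · rw [← det_expMat_update_neg, ← h', h, Function.update_eq_self]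

theorem det_expMat_update_eq_zero {c c' : Fin n} (hc : c' ≠ c) {m : ℤ} (h : |m| = rho c') :
    (expMat x (Function.update rho c m)).det = 0 := by
  have key : (expMat x (Function.update rho c (rho c'))).det = 0 := by
    refine Matrix.det_zero_of_column_eq hc fun i => ?_
    simp [expMat, hc]
  rcases abs_choice m with h' | h'
  · rw [← h', h, key]
  · rw [← det_expMat_update_neg, ← h', h, key]

end Determinants

/-- The index `r̄ = min {r, 2n - r}`. -/
def hookIdx (n r : ℕ) : Fin (n + 1) := ⟨min r (2 * n - r), by omega⟩

theorem rho_hookIdx {n r : ℕ} (hr : r ≤ 2 * n) : rho (hookIdx n r) = |(n : ℤ) - r| := by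
  simp only [rho, hookIdx]
  rcases abs_cases ((n : ℤ) - r) with h | h <;> omega

/-- The shifted hook weight is ρ with its entry at r̄ removed and k - r + n put in front; the cycle
moves that entry back to position r̄. -/
theorem hook_add_rho_comp_cycleRange {n k r : ℕ} :
    (hook (n + 1) k r + rho) ∘ (hookIdx n r).cycleRange =
      Function.update rho (hookIdx n r) ((k : ℤ) - r + n) := by
  ext j
  rw [Function.comp_apply]
  rcases lt_trichotomy j (hookIdx n r) with h | h | h
  · have h1 := Fin.coe_cycleRange_of_lt h
    have h2 : (j : ℕ) < min r (2 * n - r) := h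
    rw [Function.update_of_ne h.ne, Pi.add_apply]
    simp only [hook, rho, h1]
    rw [if_neg (by omega), if_pos (by omega)]
    push_cast
    ring
  · rw [h, Fin.cycleRange_of_eq rfl, Function.update_self]
    simp [hook, rho]
  · have h2 : min r (2 * n - r) < (j : ℕ) := h
    rw [Fin.cycleRange_of_gt h, Function.update_of_ne h.ne', Pi.add_apply]
    simp only [hook]
    rw [if_neg (by omega), if_neg (by omega), zero_add]

theorem det_expMat_update_hookIdx {F : Type*} [Field F] {n k r : ℕ} (x : Fin (n + 1) → F)
    (hr : r ≤ 2 * n) : (expMat x (Function.update rho (hookIdx n r) ((k : ℤ) - r + n))).det =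
      (-1) ^ r * (expMat x (hook (n + 1) k r + rho)).det := by
  rw [← hook_add_rho_comp_cycleRange]
  have h : expMat x ((hook (n + 1) k r + rho) ∘ (hookIdx n r).cycleRange) =
      (expMat x (hook (n + 1) k r + rho)).submatrix id (hookIdx n r).cycleRange := rfl
  rw [h, Matrix.det_permute', Fin.sign_cycleRange]
  congr 1
  -- The cycle has sign (-1)^{r̄}, and r̄ ≡ r mod 2.
  have h1 : (-1 : F) ^ (min r (2 * n - r)) = (-1) ^ r := by
    refine neg_one_pow_congr ?_
    rcases min_choice r (2 * n - r) with h | h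
    · rw [h]
    · rw [h, Nat.even_sub hr]
      simp
  simpa [hookIdx] using h1

/-! ### The elements `G_{n,k}` in terms of hook weights -/

theorem sum_add_sum_reflect {A : Type*} [AddCommGroup A] (f : ℕ → A) (n : ℕ) :
    ∑ c ∈ Finset.range (n + 1), (f c + f (2 * n - c)) =
      ∑ r ∈ Finset.range (2 * n + 1), (f r + if r = n then f r else 0) := by
  rw [Finset.sum_add_distrib, Finset.sum_add_distrib, Finset.sum_ite_eq',
    if_pos (Finset.mem_range.2 (by omega))]
  have h1 := Finset.sum_range_reflect (fun j => f (n + j)) (n + 1)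
  have h2 : ∑ c ∈ Finset.range (n + 1), f (2 * n - c) =
      ∑ c ∈ Finset.range (n + 1), f (n + (n + 1 - 1 - c)) := by
    refine Finset.sum_congr rfl fun c hc => ?_
    rw [Finset.mem_range] at hc
    congr 1
    omega
  have h3 := Finset.sum_range_succ' (fun j => f (n + j)) n
  rw [add_zero] at h3
  rw [h2, h1, h3, show 2 * n + 1 = n + 1 + n by ring,
    Finset.sum_range_add f (n + 1) n, add_assoc]
  have h4 : ∀ j, f (n + (j + 1)) = f (n + 1 + j) := fun j => by rw [add_assoc, add_comm j]
  simp only [h4]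

theorem qE_ne_zero (n : ℕ) : qE n ≠ 0 :=
  (map_ne_zero _).2 (pow_ne_zero _ RatFunc.X_ne_zero)

theorem expVar_add_inv_injective (n : ℕ) :
    Function.Injective fun i => expVar n i + (expVar n i)⁻¹ := by
  have h : ∀ i, expVar n i + (expVar n i)⁻¹ = toExpField n (yElt i) := by
    intro i
    rw [yElt, map_add, toExpField_mono, toExpField_mono, wt_inl, wt_inr, e_neg, expVar]
  intro i j hij
  simp only [h] at hij
  by_contra hne
  exact yElt_sub_ne_zero hne (sub_eq_zero.2 (toExpField_injective n hij))

/-- Column c gives r = c from the exponent k + ρ_c and r = 2n - c from k - ρ_c. For c = n both are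
the same term, hence the doubling at r = n. -/
theorem det_mul_chG (n k : ℕ) :
    (expMat (expVar (n + 1)) rho).det * chG (n + 1) k = ∑ r ∈ Finset.range (2 * n + 1),
      (1 + if r = n then 1 else 0) * (qE (n + 1) ^ (2 * (n : ℤ) - 2 * r) *
        (expMat (expVar (n + 1))
          (Function.update rho (hookIdx n r) ((k : ℤ) - r + n))).det) := by
  let f : ℕ → ExpField (n + 1) := fun r => qE (n + 1) ^ (2 * (n : ℤ) - 2 * r) *
    (expMat (expVar (n + 1)) (Function.update rho (hookIdx n r) ((k : ℤ) - r + n))).det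
  rw [chG, det_mul_G (x := expVar (n + 1)) (fun i => e_ne_zero _) (expVar_add_inv_injective (n + 1))
    (qE_ne_zero (n + 1)) (fun i => rfl)
    (fun i => by simp only [eps, Units.val_neg, Units.val_one, Pi.single_neg, e_neg, expVar])]
  trans ∑ c ∈ Finset.range (n + 1), (f c + f (2 * n - c))
  · rw [← Fin.sum_univ_eq_sum_range (fun c => f c + f (2 * n - c))]
    refine Finset.sum_congr rfl fun c _ => ?_
    have hc := c.2
    have h1 : hookIdx n c = c := Fin.ext (by simp only [hookIdx]; omega)
    have h2 : hookIdx n (2 * n - c) = c := Fin.ext (by simp only [hookIdx]; omega)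
    have h3 : ((2 * n - c : ℕ) : ℤ) = 2 * n - c := by omega
    have h4 : rho c = (n : ℤ) - c := by simp [rho]
    simp only [f, h1, h2, h3, h4]
    congr 3 <;> [skip; (congr 2; ring); skip; (congr 2; ring)] <;> ring
  · rw [sum_add_sum_reflect]
    refine Finset.sum_congr rfl fun r _ => ?_
    split_ifs <;> ring

/-- The doubling at r = n matches the factor 2 of the character formula for a nonzero last
coordinate, which occurs only there. -/
theorem det_mul_chi_hook {n k r : ℕ} (hn : n ≠ 0) (hr : r ≤ 2 * n) (hk : r < k) :
    (expMat (expVar (n + 1)) rho).det *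
        (chi (hook (n + 1) k r) + if r = n then chi (hookBar (n + 1) k) else 0) =
      (1 + if r = n then 1 else 0) * (expMat (expVar (n + 1)) (hook (n + 1) k r + rho)).det := by
  split_ifs with h
  · subst h
    rw [det_mul_chi_add_of_last_ne_zero (hasHighest_hook hk) (strictDom_hook hk)
      (hasHighest_hookBar hn hk) (strictDom_hookBar hk) _ (hookBar_eq_update hn),
      one_add_one_eq_two]
    simp only [hook, Fin.val_last]
    split_ifs <;> omega
  · rw [add_zero, add_zero, one_mul, det_mul_chi_of_last_eq_zero (hasHighest_hook hk)
      (strictDom_hook hk)]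
    simp only [hook, Fin.val_last]
    rw [if_neg hn, if_neg (by omega)]

/-- For k ≤ r the number |k - r + n| is at most n, hence an entry of ρ. It is the entry |n - r| of
the replaced column only if 2r = 2n + k, as k ≠ 0; otherwise two columns coincide. -/
theorem det_expMat_update_of_le {n k r : ℕ} (hr : r ≤ 2 * n) (hk : k ≤ r) (hk0 : k ≠ 0) :
    (expMat (expVar (n + 1)) (Function.update rho (hookIdx n r) ((k : ℤ) - r + n))).det =
      if 2 * r = 2 * n + k then (expMat (expVar (n + 1)) rho).det else 0 := by
  split_ifs with h
  · refine det_expMat_update_of_abs_eq _ ?_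
    rw [rho_hookIdx hr, abs_eq_abs]
    omega
  · have hlt : |(k : ℤ) - r + n| ≤ n := by rw [abs_le]; omega
    have h0 := abs_nonneg ((k : ℤ) - r + n)
    let c : Fin (n + 1) := ⟨n - |(k : ℤ) - r + n|.toNat, by omega⟩
    have hc : |(k : ℤ) - r + n| = rho c := by
      simp only [rho, c]
      omega
    refine det_expMat_update_eq_zero _ (c' := c) ?_ hc
    intro hcr
    rw [hcr, rho_hookIdx hr, abs_eq_abs] at hc
    omega

/-- The expansion of `Ch G_{n,k}` for `k ≥ 1`. -/
theorem chG_eq_sum {n k : ℕ} (hn : n ≠ 0) (hk : k ≠ 0) :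
    chG (n + 1) k = ∑ r ∈ Finset.range (2 * n + 1),
      if r < k then (-1) ^ r * qE (n + 1) ^ (2 * (n : ℤ) - 2 * r) *
        (chi (hook (n + 1) k r) + if r = n then chi (hookBar (n + 1) k) else 0)
      else if 2 * r = 2 * n + k then qE (n + 1) ^ (-(k : ℤ)) else 0 := by
  refine mul_left_cancel₀ (det_expMat_rho_ne_zero n.succ_pos) ?_
  rw [det_mul_chG, Finset.mul_sum]
  refine Finset.sum_congr rfl fun r hr => ?_
  have hr' : r ≤ 2 * n := by rw [Finset.mem_range] at hr; omega
  by_cases hrk : r < k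
  · rw [if_pos hrk, det_expMat_update_hookIdx _ hr']
    linear_combination -((-1) ^ r * qE (n + 1) ^ (2 * (n : ℤ) - 2 * r)) *
      det_mul_chi_hook hn hr' hrk
  · rw [if_neg hrk, det_expMat_update_of_le hr' (by omega) hk]
    split_ifs with h1 h2 h2
    -- At r = n the condition 2r = 2n + k would force k = 0, so the surviving term is never doubled.
    · omega
    · rw [mul_zero, mul_zero, mul_zero]
    · rw [show 2 * (n : ℤ) - 2 * r = -k by omega]
      ring
    · rw [mul_zero, mul_zero, mul_zero]

/-- For k = 0 every replaced exponent is ±ρ_c, so each determinant is that of ρ; the doubled middle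
term q^0 supplies the extra 1. -/
theorem chG_zero (n : ℕ) : chG (n + 1) 0 =
    1 + ∑ r ∈ Finset.range (2 * n + 1), qE (n + 1) ^ (2 * (n : ℤ) - 2 * r) := by
  refine mul_left_cancel₀ (det_expMat_rho_ne_zero n.succ_pos) ?_
  have h : ∀ r ∈ Finset.range (2 * n + 1), (1 + if r = n then 1 else 0) *
      (qE (n + 1) ^ (2 * (n : ℤ) - 2 * r) * (expMat (expVar (n + 1))
        (Function.update rho (hookIdx n r) (((0 : ℕ) : ℤ) - r + n))).det) =
      (expMat (expVar (n + 1)) rho).det *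
        (qE (n + 1) ^ (2 * (n : ℤ) - 2 * r) + if r = n then 1 else 0) := by
    intro r hr
    rw [Finset.mem_range] at hr
    rw [det_expMat_update_of_abs_eq]
    · split_ifs with h
      · subst h
        rw [sub_self, zpow_zero]
        ring
      · ring
    · rw [rho_hookIdx (by omega)]
      congr 1
      push_cast
      ring
  rw [det_mul_chG, Finset.sum_congr rfl h, ← Finset.mul_sum, Finset.sum_add_distrib,
    Finset.sum_ite_eq', if_pos (Finset.mem_range.2 (by omega)), add_comm (1 : ExpField (n + 1))]

end TypeD

end

theorem theorem3p7 (n : ℕ) (hn : 4 ≤ n) (k : ℕ) :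
    (k = 0 →
      TypeD.chG n k =
        1 + ∑ r ∈ Finset.range (2 * n - 1), TypeD.qE n ^ (2 * (n : ℤ) - 2 - 2 * (r : ℤ))) ∧
    (1 ≤ k → k ≤ 2 * n - 2 → Even k →
      TypeD.chG n k =
        TypeD.qE n ^ (-(k : ℤ)) +
          ∑ r ∈ Finset.range k,
            (-1) ^ r * TypeD.qE n ^ (2 * (n : ℤ) - 2 - 2 * (r : ℤ)) *
              (TypeD.chi (TypeD.hook n k r) +
                if r = n - 1 then TypeD.chi (TypeD.hookBar n k) else 0)) ∧
    (1 ≤ k → ¬ (k ≤ 2 * n - 2 ∧ Even k) →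
      TypeD.chG n k =
        ∑ r ∈ Finset.range (min (k - 1) (2 * n - 2) + 1),
          (-1) ^ r * TypeD.qE n ^ (2 * (n : ℤ) - 2 - 2 * (r : ℤ)) *
            (TypeD.chi (TypeD.hook n k r) +
              if r = n - 1 then TypeD.chi (TypeD.hookBar n k) else 0)) := by
  obtain ⟨n, rfl⟩ : ∃ m, n = m + 1 := ⟨n - 1, by omega⟩
  have hexp : ∀ r : ℕ, 2 * ((n + 1 : ℕ) : ℤ) - 2 - 2 * (r : ℤ) = 2 * (n : ℤ) - 2 * r := by
    intro r
    push_cast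
    ring
  simp only [hexp, Nat.add_sub_cancel, show 2 * (n + 1) - 1 = 2 * n + 1 by omega,
    show 2 * (n + 1) - 2 = 2 * n by omega]
  refine ⟨?_, fun hk hle heven => ?_, fun hk hnot => ?_⟩
  · rintro rfl
    exact TypeD.chG_zero n
  · rw [TypeD.chG_eq_sum (by omega) (by omega),
      ← Finset.sum_range_add_sum_Ico _ (show k ≤ 2 * n + 1 by omega),
      add_comm (TypeD.qE (n + 1) ^ _)]
    congr 1
    · refine Finset.sum_congr rfl fun r hr => ?_
      rw [if_pos (Finset.mem_range.1 hr)]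
    · obtain ⟨j, rfl⟩ := heven
      -- With k = 2j the condition 2r = 2n + k selects r = n + j, and k ≤ 2n keeps it in the range k
      -- ≤ r ≤ 2n.
      rw [Finset.sum_eq_single (n + j)]
      · rw [if_neg (by omega), if_pos (by omega)]
      · intro r hr hne
        rw [Finset.mem_Ico] at hr
        rw [if_neg (by omega), if_neg (by omega)]
      · intro h
        exact absurd (Finset.mem_Ico.2 (by omega)) h
  · rw [TypeD.chG_eq_sum (by omega) (by omega),
      ← Finset.sum_range_add_sum_Ico _ (show min (k - 1) (2 * n) + 1 ≤ 2 * n + 1 by omega),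
      Finset.sum_eq_zero (s := Finset.Ico _ _), add_zero]
    · refine Finset.sum_congr rfl fun r hr => ?_
      rw [Finset.mem_range] at hr
      rw [if_pos (by omega)]
    · intro r hr
      rw [Finset.mem_Ico] at hr
      rw [if_neg (by omega), if_neg]
      intro h
      -- A solution of 2r = 2n + k with r ≤ 2n makes k even and at most 2n, the case excluded here.
      exact hnot ⟨by omega, by rw [Nat.even_iff]; omega⟩
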